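/- Let $[n]=\{1,\dots,n\}$. A family $\mathcal F$ of subsets of $[n]$ is called $(s,t)$-union-intersecting if for all $s+t$ pairwise different members $F_1,\dots,F_s,G_1,\dots,G_t\in\mathcal F$ $$\Big(\bigcup_{i=1}^s F_i\Big)\cap\Big(\bigcup_{j=1}^t G_j\Big)\neq\emptyset .$$ Let $f(n,s,t)$ denote the size of the largest $(s,t)$-union-intersecting family of subsets of $[n]$. Then the following hold. (a) For all $n\ge 3$, $f(n,1,1)=2^{n-1}$. (b) For all $n\ge 3$, $$f(n,1,2)=\begin{cases}\displaystyle\sum_{i=n/2}^n\binom ni & \text{if } n \text{ is even},\\[2mm] \displaystyle\binom{n-1}{\frac{n-3}2}+\sum_{i=(n+1)/2}^n\binom ni & \text{if } n \text{ is odd}.\end{cases}$$ (c) For all $n\ge 3$, $$f(n,2,2)=\begin{cases}\displaystyle\sum_{i=(n-1)/2}^n\binom ni & \text{if } n \text{ is odd},\\[2mm] \displaystyle\binom{n-1}{\frac n2-2}+\sum_{i=n/2}^n\binom ni & \text{if } n \text{ is even}.\end{cases}$$ (d) For all $n\ge 3$, $$f(n,1,3)=\begin{cases}\displaystyle\sum_{i=n/2}^n\binom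 ni & \text{if } n \text{ is even},\\[2mm] \displaystyle\binom{n-1}{\frac{n-1}2}+\sum_{i=(n+1)/2}^n\binom ni & \text{if } n \text{ is odd}.\end{cases}$$ (e) For every $t\ge 4$ there is a real constant $C=C(t)$ such that for all $n\ge 3$ $$2^{n-1}+\frac12\binom n{\lfloor n/2\rfloor}\le f(n,1,t)\le 2^{n-1}+\binom n{\lfloor n/2\rfloor}\left(\frac12+\frac{t-2}n+\frac C{n^2}\right).$$ (f) For all $s\ge 2$ and $t\ge 3$ there is a real constant $C=C(s,t)$ such that for all $n\ge 3$ $$2^{n-1}+\binom n{\lfloor n/2\rfloor}\frac n{n+2}\le f(n,s,t)\le 2^{n-1}+\binom n{\lfloor n/2\rfloor}\left(1+\frac{t+s-3}n+\frac C{n^2}\right).$$ -/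

import Mathlib

/-- A family `𝓕` of subsets of an `n`-element set is `(s,t)`-union-intersecting if for all `s + t`
pairwise different members `F₁, …, F_s, G₁, …, G_t` of `𝓕` the sets `⋃ F_i` and `⋃ G_j` have a
common element. Injectivity of `Sum.elim F G` says that the `s + t` members are pairwise
different. -/
def UnionIntersecting {n : ℕ} (s t : ℕ) (𝓕 : Finset (Finset (Fin n))) : Prop :=
  ∀ (F : Fin s → Finset (Fin n)) (G : Fin t → Finset (Fin n)),
    (∀ i, F i ∈ 𝓕) → (∀ j, G j ∈ 𝓕) → Function.Injective (Sum.elim F G) →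
    (Finset.univ.biUnion F ∩ Finset.univ.biUnion G).Nonempty

open Classical in
/-- `maxUnionIntersecting n s t` is the size of the largest `(s,t)`-union-intersecting family of
subsets of an `n`-element set. -/
noncomputable def maxUnionIntersecting (n s t : ℕ) : ℕ :=
  (Finset.univ.filter
    (fun 𝓕 : Finset (Finset (Fin n)) => UnionIntersecting s t 𝓕)).sup Finset.card

/-!
Join two members of a family `𝓕` when they are disjoint: `𝓕` is `(s,t)`-union-intersecting exactly
when this graph contains no complete bipartite graph with parts of sizes `s` and `t`. Let `𝓗` be the
complement-closed part `𝓕 ∩ 𝓕ᶜˢ`. Since `𝓕 ∪ 𝓕ᶜˢ` has at most `2 ^ n` members,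
`2 * #𝓕 ≤ 2 ^ n + #𝓗`. Passing to complements turns disjointness inside `𝓗` into
inclusion, so (the empty set aside) no member of `𝓗` lies above `s - 1` and below `t - 1` other
members (`UnionIntersecting.card_below_or_card_above`). Each upper bound is thus a forbidden
subposet problem for a complement-closed family.

* For `(1,1)` the family `𝓗` is empty.
* For `(1,2)` and `n` odd, `𝓗` is an antichain; its lower half is intersecting and moves up to the
  lower of the two middle levels, where the Erdős–Ko–Rado theorem applies
  (`card_le_of_isAntichain_of_compls_eq`).
* For `(1,3)` every member of `𝓗` is comparable to at most one other, and counting maximal chains,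
  encoded as numberings and their prefixes, gives the bound of Katona and Tarján
  (`card_le_of_comparable_le_one`). For `n` even this also settles `(1,2)`.
* For `(2,2)` there are no chains of three members. For `n` odd, Sperner's theorem is applied twice.
  For `n` even, one minimal member from each complementary pair gives an antichain without
  complementary members, which is moved to the three middle levels and bounded there by Katona's
  circle method (`card_le_of_isAntichain_of_compl_notMem`).
* In general `𝓗` splits, up to polynomially many sets near the top and the bottom, into a family
  whose members have at most `s - 2` proper subsets in it and one whose members have at most `t - 2`
  proper supersets in it. A second-order LYM inequality bounds each part
  (`card_mul_le_of_card_above_le`).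

For `(1,1)` the sets containing a fixed point form an extremal family. The other lower bounds come
from all sets of size at least some `k` about `n / 2`, where needed together with those sets of size
`k - 1` that contain, or that avoid, a fixed point.
-/

/-! ### The disjointness graph of a union-intersecting family -/

section DisjointnessGraph

open Finset
open scoped FinsetFamily

variable {n s t : ℕ} {𝓕 : Finset (Finset (Fin n))}

/-- A family is `(s,t)`-union-intersecting iff the graph joining disjoint members has no complete
bipartite subgraph with parts of sizes `s` and `t`. -/
theorem unionIntersecting_iff :
    UnionIntersecting s t 𝓕 ↔ ∀ S T : Finset (Finset (Fin n)), S ⊆ 𝓕 → T ⊆ 𝓕 → #S = s → #T = t →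
      Disjoint S T → ∃ A ∈ S, ∃ B ∈ T, (A ∩ B).Nonempty := by
  constructor
  · rintro h S T hS hT rfl rfl hST
    obtain ⟨x, hx⟩ := h (fun i ↦ (S.equivFin.symm i : Finset (Fin n)))
      (fun j ↦ (T.equivFin.symm j : Finset (Fin n)))
      (fun i ↦ hS (S.equivFin.symm i).2) (fun j ↦ hT (T.equivFin.symm j).2) (by
        refine Function.Injective.sumElim
          (Subtype.val_injective.comp S.equivFin.symm.injective)
          (Subtype.val_injective.comp T.equivFin.symm.injective) fun i j hij ↦ ?_
        exact disjoint_left.1 hST (S.equivFin.symm i).2 (by rw [hij]; exact (T.equivFin.symm j).2))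
    simp only [mem_inter, mem_biUnion, mem_univ, true_and] at hx
    obtain ⟨⟨i, hi⟩, j, hj⟩ := hx
    exact ⟨_, (S.equivFin.symm i).2, _, (T.equivFin.symm j).2, x, mem_inter.2 ⟨hi, hj⟩⟩
  · intro h F G hF hG hinj
    have hFi : Function.Injective F := fun i j hij ↦ by simpa using @hinj (.inl i) (.inl j) hij
    have hGi : Function.Injective G := fun i j hij ↦ by simpa using @hinj (.inr i) (.inr j) hij
    obtain ⟨A, hA, B, hB, x, hx⟩ := h (univ.image F) (univ.image G)
      (by simpa [image_subset_iff] using hF) (by simpa [image_subset_iff] using hG)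
      (by simp [card_image_of_injective _ hFi]) (by simp [card_image_of_injective _ hGi]) (by
        rw [disjoint_left]
        simp only [mem_image, mem_univ, true_and]
        rintro _ ⟨i, rfl⟩ ⟨j, hj⟩
        simpa using @hinj (.inr j) (.inl i) hj)
    simp only [mem_image, mem_univ, true_and] at hA hB
    obtain ⟨i, rfl⟩ := hA
    obtain ⟨j, rfl⟩ := hB
    refine ⟨x, ?_⟩
    simp only [mem_inter, mem_biUnion, mem_univ, true_and] at hx ⊢
    exact ⟨⟨i, hx.1⟩, j, hx.2⟩

theorem UnionIntersecting.symm (h : UnionIntersecting s t 𝓕) : UnionIntersecting t s 𝓕 := by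
  rw [unionIntersecting_iff] at h ⊢
  intro S T hS hT hs ht hST
  obtain ⟨A, hA, B, hB, hAB⟩ := h T S hT hS ht hs hST.symm
  exact ⟨B, hB, A, hA, by rwa [inter_comm]⟩

/-- The sizes of the two parts need only be lower bounds. -/
theorem UnionIntersecting.exists_inter_nonempty (h : UnionIntersecting s t 𝓕)
    {S T : Finset (Finset (Fin n))} (hS : S ⊆ 𝓕) (hT : T ⊆ 𝓕) (hs : s ≤ #S) (ht : t ≤ #T)
    (hST : Disjoint S T) : ∃ A ∈ S, ∃ B ∈ T, (A ∩ B).Nonempty := by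
  rw [unionIntersecting_iff] at h
  obtain ⟨S', hS', rfl⟩ := exists_subset_card_eq hs
  obtain ⟨T', hT', rfl⟩ := exists_subset_card_eq ht
  obtain ⟨A, hA, B, hB, hAB⟩ := h S' T' (hS'.trans hS) (hT'.trans hT) rfl rfl
    (disjoint_of_subset_left hS' (disjoint_of_subset_right hT' hST))
  exact ⟨A, hS' hA, B, hT' hB, hAB⟩

theorem UnionIntersecting.mono {s' t' : ℕ} (hs : s ≤ s') (ht : t ≤ t')
    (h : UnionIntersecting s t 𝓕) : UnionIntersecting s' t' 𝓕 := by
  rw [unionIntersecting_iff]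
  rintro S T hS hT rfl rfl hST
  exact h.exists_inter_nonempty hS hT hs ht hST

theorem UnionIntersecting.card_le_max (h : UnionIntersecting s t 𝓕) :
    #𝓕 ≤ maxUnionIntersecting n s t := by
  classical
  unfold maxUnionIntersecting
  exact le_sup (f := Finset.card) (by simpa using h)

theorem exists_card_eq_maxUnionIntersecting (n s t : ℕ) (h : 0 < s + t) :
    ∃ 𝓕 : Finset (Finset (Fin n)), UnionIntersecting s t 𝓕 ∧ #𝓕 = maxUnionIntersecting n s t := by
  classical
  unfold maxUnionIntersecting
  have hne : (univ.filter
      (fun 𝓕 : Finset (Finset (Fin n)) => UnionIntersecting s t 𝓕)).Nonempty := by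
    refine ⟨∅, ?_⟩
    simp only [mem_filter, mem_univ, true_and, unionIntersecting_iff]
    intro S T hS hT hs ht
    simp only [subset_empty] at hS hT
    subst hS hT
    simp at hs ht
    omega
  obtain ⟨𝓕, h𝓕, he⟩ := exists_mem_eq_sup _ hne Finset.card
  exact ⟨𝓕, by simpa using h𝓕, he.symm⟩

theorem maxUnionIntersecting_mono {s' t' : ℕ} (h : 0 < s + t) (hs : s ≤ s') (ht : t ≤ t') :
    maxUnionIntersecting n s t ≤ maxUnionIntersecting n s' t' := by
  obtain ⟨𝓕, h𝓕, he⟩ := exists_card_eq_maxUnionIntersecting n s t h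
  exact he ▸ (h𝓕.mono hs ht).card_le_max

/-- A family and its family of complements together have at most `2 ^ n` members, up to the members
whose complement is a member as well. -/
theorem two_mul_card_le_add_card_inter_compls (𝓕 : Finset (Finset (Fin n))) :
    2 * #𝓕 ≤ 2 ^ n + #(𝓕 ∩ 𝓕ᶜˢ) := by
  have h1 := card_union_add_card_inter 𝓕 𝓕ᶜˢ
  have h2 : #(𝓕 ∪ 𝓕ᶜˢ) ≤ 2 ^ n := by
    simpa using card_le_univ (𝓕 ∪ 𝓕ᶜˢ)
  rw [card_compls] at h1
  omega

/-- Within the complement-closed part of the family, no nonempty `B` lies above `s - 1` members and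
below `t - 1` members: `B` with the former, and the complements of `B` and the latter, would be the
two parts of a forbidden complete bipartite graph. -/
theorem UnionIntersecting.card_below_or_card_above (h : UnionIntersecting s t 𝓕)
    {𝓗 : Finset (Finset (Fin n))} (h𝓗 : 𝓗 ⊆ 𝓕 ∩ 𝓕ᶜˢ) (he : ∅ ∉ 𝓗) {B : Finset (Fin n)}
    (hB : B ∈ 𝓗) :
    #{A ∈ 𝓗 | A ⊂ B} + 1 < s ∨ #{C ∈ 𝓗 | B ⊂ C} + 1 < t := by
  by_contra! hcon
  set S := insert B {A ∈ 𝓗 | A ⊂ B} with hS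
  set T := (insert B {C ∈ 𝓗 | B ⊂ C})ᶜˢ with hT
  have hSB : ∀ A ∈ S, A ∈ 𝓗 ∧ A ⊆ B := by
    intro A hA
    simp only [hS, mem_insert, mem_filter] at hA
    obtain rfl | hA := hA
    · exact ⟨hB, Subset.rfl⟩
    · exact ⟨hA.1, hA.2.subset⟩
  have hTB : ∀ C ∈ T, Cᶜ ∈ 𝓗 ∧ B ⊆ Cᶜ := by
    intro A hA
    simp only [hT, mem_compls, mem_insert, mem_filter] at hA
    obtain hA | hA := hA
    · exact ⟨hA ▸ hB, hA.ge⟩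
    · exact ⟨hA.1, hA.2.subset⟩
  obtain ⟨A, hA, C, hC, x, hx⟩ := h.exists_inter_nonempty (S := S) (T := T)
    (fun A hA ↦ (mem_inter.1 (h𝓗 (hSB A hA).1)).1)
    (fun C hC ↦ by simpa using (mem_inter.1 (h𝓗 (hTB C hC).1)).2)
    (by rw [hS, card_insert_of_notMem (by simp)]; exact hcon.1)
    (by rw [hT, card_compls, card_insert_of_notMem (by simp)]; exact hcon.2)
    (by
      rw [disjoint_left]
      intro A hA hA'
      have h1 : A ⊆ Aᶜ := (hSB A hA).2.trans (hTB A hA').2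
      have h2 : A = ∅ := by
        rw [eq_empty_iff_forall_notMem]
        exact fun x hx ↦ mem_compl.1 (h1 hx) hx
      exact he (h2 ▸ (hSB A hA).1))
  rw [mem_inter] at hx
  exact mem_compl.1 ((hTB C hC).2 ((hSB A hA).2 hx.1)) hx.2

/-- The empty set is disjoint from everything. -/
theorem UnionIntersecting.card_le_of_empty_mem (h : UnionIntersecting 1 t 𝓕) (he : ∅ ∈ 𝓕) :
    #𝓕 ≤ t := by
  by_contra! hcon
  obtain ⟨A, hA, B, hB, hAB⟩ := h.exists_inter_nonempty (S := {∅}) (T := 𝓕.erase ∅)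
    (by simpa using he) (erase_subset _ _) (by simp) (by rw [card_erase_of_mem he]; omega)
    (by simp)
  simp only [mem_singleton] at hA
  simp [hA] at hAB

/-- The empty set can be added to the part of size `s` of any forbidden bipartite graph. -/
theorem UnionIntersecting.erase_empty (h : UnionIntersecting (s + 1) t 𝓕) (he : ∅ ∈ 𝓕) :
    UnionIntersecting s t (𝓕.erase ∅) := by
  rw [unionIntersecting_iff]
  rintro S T hS hT rfl rfl hST
  have hS' : ∅ ∉ S := fun h ↦ by simpa using hS h
  have hT' : ∅ ∉ T := fun h ↦ by simpa using hT h
  obtain ⟨A, hA, B, hB, hAB⟩ := h.exists_inter_nonempty (S := insert ∅ S) (T := T)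
    (insert_subset he (hS.trans (erase_subset _ _))) (hT.trans (erase_subset _ _))
    (by rw [card_insert_of_notMem hS']) le_rfl (by simp [hST, hT'])
  obtain rfl | hA := mem_insert.1 hA
  · simp at hAB
  · exact ⟨A, hA, B, hB, hAB⟩

end DisjointnessGraph

/-! ### Counting numberings by their prefixes in a family -/

section ChainCounting

open Finset Numbering
open scoped Nat

variable {X : Type*} [Fintype X] [DecidableEq X]

theorem card_prefixed_inter_prefixed_le {A B : Finset X} (h : A ⊆ B) :
    #(prefixed A ∩ prefixed B) ≤
      (#A)! * ((#B - #A)! * (Fintype.card X - #B)!) := by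
  have hAB := card_le_card h
  have hB' : #(B.subtype (· ∈ Aᶜ)) = #B - #A := by
    rw [card_subtype, ← card_sdiff_of_subset h]
    congr 1
    ext x
    simp
  have hcard : #((univ : Finset (Numbering A)) ×ˢ
      prefixed (X := ↑(Aᶜ)) (B.subtype (· ∈ Aᶜ))) =
      (#A)! * ((#B - #A)! * (Fintype.card X - #B)!) := by
    rw [card_product, card_univ, Fintype.card_numbering, card_prefixed, hB']
    simp only [Fintype.card_coe, card_compl]
    congr 3
    omega
  rw [← hcard, ← card_attach]
  refine card_le_card_of_injOn
    (fun f ↦ prefixedEquiv A ⟨f.1, (mem_inter.1 f.2).1⟩) ?_ ?_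
  · rintro ⟨f, hf⟩ -
    simp only [mem_coe, mem_product, mem_univ, true_and, mem_prefixed]
    have h1 := mem_prefixed.1 (mem_inter.1 hf).1
    have h2 := mem_prefixed.1 (mem_inter.1 hf).2
    rintro ⟨x, hx⟩
    have h3 : ¬ (f x : ℕ) < #A := fun h ↦ mem_compl.1 hx ((h1 x).2 h)
    have h4 := h2 x
    rw [hB', mem_subtype]
    change x ∈ B ↔ (f x : ℕ) - #A < #B - #A
    rw [h4]
    omega
  · rintro ⟨f, hf⟩ - ⟨g, hg⟩ - hfg
    simpa using hfg

theorem factorial_mul_factorial_le_factorial_pred {x y : ℕ} (hx : 0 < x) (hy : 0 < y) :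
    x ! * y ! ≤ (x + y - 1)! := by
  obtain ⟨y, rfl⟩ := Nat.exists_eq_succ_of_ne_zero hy.ne'
  have h1 : x ! * y ! * (x + y).choose x = (x + y)! := by
    have := Nat.choose_mul_factorial_mul_factorial (Nat.le_add_right x y)
    rw [Nat.add_sub_cancel_left] at this
    linarith
  have h2 : y + 1 ≤ (x + y).choose x := by
    have h3 : (y + 1).choose y ≤ (x + y).choose y := Nat.choose_le_choose y (by omega)
    rw [Nat.choose_succ_self_right] at h3
    rwa [Nat.choose_symm_add]
  calc x ! * (y + 1)! = x ! * y ! * (y + 1) := by rw [Nat.factorial_succ]; ring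
    _ ≤ x ! * y ! * (x + y).choose x := Nat.mul_le_mul_left _ h2
    _ = _ := h1

theorem card_prefixed_inter_prefixed_le_left {A B : Finset X} (h : A ⊂ B)
    (hB : #B < Fintype.card X) :
    #(prefixed A ∩ prefixed B) ≤ (#A)! * (Fintype.card X - #A - 1)! := by
  have hAB := card_lt_card h
  refine (card_prefixed_inter_prefixed_le h.subset).trans (Nat.mul_le_mul_left _ ?_)
  refine (factorial_mul_factorial_le_factorial_pred (by omega) (by omega)).trans_eq ?_
  congr 1
  omega

theorem card_prefixed_inter_prefixed_le_right {A B : Finset X} (h : A ⊂ B) (hA : 0 < #A) :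
    #(prefixed A ∩ prefixed B) ≤ (#B - 1)! * (Fintype.card X - #B)! := by
  have hAB := card_lt_card h
  refine (card_prefixed_inter_prefixed_le h.subset).trans ?_
  rw [← mul_assoc]
  refine Nat.mul_le_mul_right _ ?_
  refine (factorial_mul_factorial_le_factorial_pred (by omega) (by omega)).trans_eq ?_
  congr 1
  omega

/-- A second-order form of the LYM inequality. The members that are prefixes of a given numbering
form a chain, and a chain has at most one member more than it has comparable pairs. -/
theorem sum_card_prefixed_le (𝓗 : Finset (Finset X)) :
    ∑ A ∈ 𝓗, #(prefixed A) ≤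
      (Fintype.card X)! + ∑ A ∈ 𝓗, ∑ B ∈ 𝓗 with A ⊂ B, #(prefixed A ∩ prefixed B) := by
  have key : ∀ f : Numbering X, #{A ∈ 𝓗 | f ∈ prefixed A} ≤
      1 + ∑ A ∈ 𝓗, ∑ B ∈ 𝓗 with A ⊂ B, if f ∈ prefixed A ∩ prefixed B then 1 else 0 := by
    intro f
    set c := {A ∈ 𝓗 | f ∈ prefixed A} with hc
    rcases c.eq_empty_or_nonempty with h0 | hne
    · simp [h0]
    obtain ⟨A₀, hA₀, hmin⟩ := exists_min_image c Finset.card hne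
    have hA₀' := mem_filter.1 hA₀
    have h1 : c.erase A₀ ⊆ {B ∈ {B ∈ 𝓗 | A₀ ⊂ B} | f ∈ prefixed A₀ ∩ prefixed B} := by
      intro B hB
      obtain ⟨hne, hBc⟩ := mem_erase.1 hB
      have hB' := mem_filter.1 hBc
      have hsub : A₀ ⊆ B := (mem_prefixed.1 hA₀'.2).subset_of_card_le_card
        (mem_prefixed.1 hB'.2) (hmin B hBc)
      exact mem_filter.2 ⟨mem_filter.2 ⟨hB'.1, hsub.ssubset_of_ne hne.symm⟩,
        mem_inter.2 ⟨hA₀'.2, hB'.2⟩⟩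
    have h2 := card_le_card h1
    rw [card_erase_of_mem hA₀] at h2
    have h3 : #{B ∈ {B ∈ 𝓗 | A₀ ⊂ B} | f ∈ prefixed A₀ ∩ prefixed B} ≤
        ∑ A ∈ 𝓗, ∑ B ∈ 𝓗 with A ⊂ B, if f ∈ prefixed A ∩ prefixed B then 1 else 0 := by
      rw [card_filter]
      exact single_le_sum
        (f := fun A ↦ ∑ B ∈ 𝓗 with A ⊂ B, if f ∈ prefixed A ∩ prefixed B then 1 else 0)
        (fun _ _ ↦ Nat.zero_le _) hA₀'.1
    omega
  calc ∑ A ∈ 𝓗, #(prefixed A)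
      = ∑ A ∈ 𝓗, ∑ f : Numbering X, if f ∈ prefixed A then 1 else 0 := by
        refine sum_congr rfl fun A _ ↦ ?_
        rw [← card_filter, filter_mem_eq_inter, univ_inter]
    _ = ∑ f : Numbering X, #{A ∈ 𝓗 | f ∈ prefixed A} := by
        rw [sum_comm]; simp only [card_filter]
    _ ≤ ∑ f : Numbering X, (1 +
        ∑ A ∈ 𝓗, ∑ B ∈ 𝓗 with A ⊂ B, if f ∈ prefixed A ∩ prefixed B then 1 else 0) :=
        sum_le_sum fun f _ ↦ key f
    _ = _ := by
        rw [sum_add_distrib]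
        congr 1
        · rw [sum_const, card_univ, Fintype.card_numbering, smul_eq_mul, mul_one]
        · rw [sum_comm]
          refine sum_congr rfl fun A _ ↦ ?_
          rw [sum_comm]
          refine sum_congr rfl fun B _ ↦ ?_
          rw [← card_filter]
          congr 1
          ext f
          simp

theorem factorial_half_mul_le {x y N : ℕ} (h : x + y = N) :
    (N / 2)! * (N - N / 2)! ≤ x ! * y ! := by
  subst h
  have h1 : x ! * y ! * (x + y).choose x = (x + y)! := by
    have := Nat.choose_mul_factorial_mul_factorial (Nat.le_add_right x y)
    rw [Nat.add_sub_cancel_left] at this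
    linarith
  have h2 := Nat.choose_mul_factorial_mul_factorial (Nat.div_le_self (x + y) 2)
  have h3 := Nat.choose_le_middle x (x + y)
  have h4 : 0 < (x + y).choose ((x + y) / 2) := Nat.choose_pos (Nat.div_le_self _ _)
  refine Nat.le_of_mul_le_mul_left ?_ h4
  calc _ = x ! * y ! * (x + y).choose x := by rw [h1, ← h2]; ring
    _ ≤ _ := by rw [mul_comm]; exact Nat.mul_le_mul_right _ h3

/-- The bound of Katona and Tarján for families in which every member is comparable to at most one
other member. -/
theorem card_le_of_comparable_le_one {𝓗 : Finset (Finset X)} (hX : 0 < Fintype.card X)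
    (he : ∅ ∉ 𝓗) (h : ∀ A ∈ 𝓗, #{B ∈ 𝓗 | B ⊂ A} + #{B ∈ 𝓗 | A ⊂ B} ≤ 1) :
    #𝓗 ≤ 2 * (Fintype.card X - 1).choose ((Fintype.card X - 1) / 2) := by
  set n := Fintype.card X with hn
  set μ := ((n - 1) / 2)! * (n - 1 - (n - 1) / 2)! with hμ
  have hμ0 : 0 < μ := Nat.mul_pos (Nat.factorial_pos _) (Nat.factorial_pos _)
  have hμle : ∀ x y, x + y = n - 1 → μ ≤ x ! * y ! := fun x y hxy ↦ factorial_half_mul_le hxy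
  have hcard : ∀ A : Finset X, #A ≤ n := fun A ↦ card_le_univ A
  -- a set of size `a` is a prefix of at least `a * μ` and of at least `(n - a) * μ` numberings
  have hleft : ∀ a, a ≤ n → a * μ ≤ a ! * (n - a)! := by
    intro a ha
    rcases a with _ | a
    · simp
    · rw [Nat.factorial_succ, mul_assoc]
      exact Nat.mul_le_mul_left _ (hμle _ _ (by omega))
  have hright : ∀ a, a ≤ n → (n - a) * μ ≤ a ! * (n - a)! := by
    intro a ha
    have := hleft (n - a) (by omega)
    rwa [Nat.sub_sub_self ha, mul_comm (n - a)!] at this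
  -- twice the excess over the average number `n * μ / 2` of numberings per member; the excesses of
  -- the members of a comparable pair pay for the numberings counted twice
  set E : Finset X → ℤ := fun A ↦ 2 * ((#A)! * (n - #A)! : ℕ) - (n * μ : ℕ) with hE
  have hE0 : ∀ A, 0 ≤ E A := by
    intro A
    have h1 := hleft _ (hcard A)
    have h2 := hright _ (hcard A)
    have h3 : n * μ = #A * μ + (n - #A) * μ := by
      rw [← add_mul, Nat.add_sub_cancel' (hcard A)]
    simp only [hE]
    zify at h1 h2 h3 ⊢
    linarith
  have hpair : ∀ A ∈ 𝓗, ∀ B ∈ 𝓗, A ⊂ B →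
      2 * (#(prefixed A ∩ prefixed B) : ℤ) ≤ E A + E B := by
    intro A hA B hB hAB
    have hA0 : 0 < #A := card_pos.2 (nonempty_iff_ne_empty.2 fun h ↦ he (h ▸ hA))
    have hab := card_lt_card hAB
    have h1 := hright _ (hcard A)
    have h2 := card_prefixed_inter_prefixed_le_right hAB hA0
    have h3 : (#B - 1) * μ + (#B - 1)! * (n - #B)! ≤ (#B)! * (n - #B)! := by
      obtain ⟨b, hb⟩ := Nat.exists_eq_succ_of_ne_zero (show #B ≠ 0 by omega)
      have h4 := hμle b (n - #B) (by have := hcard B; omega)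
      rw [hb] at h4 ⊢
      rw [Nat.succ_sub_one, Nat.succ_eq_add_one, Nat.factorial_succ]
      nlinarith
    have h5 : n * μ ≤ (n - #A) * μ + (#B - 1) * μ := by
      rw [← add_mul]
      exact Nat.mul_le_mul_right _ (by have := hcard A; omega)
    simp only [hE]
    zify at h1 h2 h3 h5 ⊢
    linarith
  have hsum : ∑ A ∈ 𝓗, ∑ B ∈ 𝓗 with A ⊂ B, (E A + E B) ≤ ∑ A ∈ 𝓗, E A := by
    have h1 : ∑ A ∈ 𝓗, ∑ B ∈ 𝓗 with A ⊂ B, E B = ∑ B ∈ 𝓗, ∑ A ∈ 𝓗 with A ⊂ B, E B := by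
      simp only [sum_filter]
      rw [sum_comm]
    simp only [sum_add_distrib]
    rw [h1, ← sum_add_distrib]
    refine sum_le_sum fun A hA ↦ ?_
    rw [sum_const, sum_const, nsmul_eq_mul, nsmul_eq_mul, ← add_mul]
    have h2 := h A hA
    have h3 : ((#{B ∈ 𝓗 | A ⊂ B} : ℤ) + #{B ∈ 𝓗 | B ⊂ A}) ≤ 1 := by
      zify at h2; linarith
    calc _ ≤ 1 * E A := mul_le_mul_of_nonneg_right h3 (hE0 A)
      _ = _ := one_mul _
  have hmain := sum_card_prefixed_le 𝓗
  simp only [card_prefixed, ← hn] at hmain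
  have hP : ∑ A ∈ 𝓗, ∑ B ∈ 𝓗 with A ⊂ B, 2 * (#(prefixed A ∩ prefixed B) : ℤ) ≤
      ∑ A ∈ 𝓗, E A :=
    le_trans (sum_le_sum fun A hA ↦ sum_le_sum fun B hB ↦
      hpair A hA B (mem_filter.1 hB).1 (mem_filter.1 hB).2) hsum
  have hEs : ∑ A ∈ 𝓗, E A = 2 * ∑ A ∈ 𝓗, (((#A)! * (n - #A)! : ℕ) : ℤ) - #𝓗 * (n * μ : ℕ) := by
    simp only [hE, sum_sub_distrib, sum_const, nsmul_eq_mul, mul_sum]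
  simp only [← mul_sum] at hP
  have hfin : #𝓗 * (n * μ) ≤ 2 * n ! := by
    zify at hmain ⊢
    push_cast at hEs hmain hP
    linarith
  have hfac : n ! = n * ((n - 1).choose ((n - 1) / 2) * μ) := by
    rw [hμ, ← mul_assoc ((n - 1).choose _),
      Nat.choose_mul_factorial_mul_factorial (Nat.div_le_self _ _), Nat.mul_factorial_pred hX.ne']
  rw [hfac] at hfin
  refine Nat.le_of_mul_le_mul_right ?_ (Nat.mul_pos hX hμ0)
  calc _ ≤ _ := hfin
    _ = _ := by ring

/-- The quantity `a! (N - 1)! (N - r)`, for `a + N = n` and `N > 2 * r + 1`, is at least its value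
at `N = n / 2`. -/
theorem factorial_mul_sub_ge (r n a N : ℕ) (h : a + N = n) (hN : 2 * r + 2 ≤ N) :
    (n - n / 2)! * (n / 2 - 1)! * (n / 2 - r) ≤ a ! * (N - 1)! * (N - r) := by
  set k := n / 2 with hk
  rcases Nat.lt_or_ge k N with hlt | hge
  · rcases Nat.le_total k r with hkr | hkr
    · simp [Nat.sub_eq_zero_of_le hkr]
    rcases Nat.eq_zero_or_pos k with hk0 | hk0
    · simp [hk0]
    have h1 : k ! * (n - k)! ≤ a ! * N ! := factorial_half_mul_le h
    have h2 : (k - r) * N ≤ (N - r) * k := by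
      zify [hkr, (by omega : r ≤ N)]
      have : (r : ℤ) * k ≤ r * N := by gcongr
      linarith
    refine Nat.le_of_mul_le_mul_left ?_ (Nat.mul_pos hk0 (by omega : 0 < N))
    calc k * N * ((n - k)! * (k - 1)! * (k - r))
        = (k * (k - 1)!) * (n - k)! * ((k - r) * N) := by ring
      _ ≤ a ! * N ! * ((N - r) * k) := by
          rw [Nat.mul_factorial_pred hk0.ne']; exact Nat.mul_le_mul h1 h2
      _ = k * N * (a ! * (N - 1)! * (N - r)) := by
          rw [← Nat.mul_factorial_pred (by omega : N ≠ 0)]; ring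
  · -- moving one element from `N` to `a ≥ N` increases the quantity
    have hstep : ∀ d, 2 * r + 2 ≤ k - d → (n - k)! * (k - 1)! * (k - r) ≤
        (n - k + d)! * (k - d - 1)! * (k - d - r) := by
      intro d
      induction d with
      | zero => simp
      | succ d ih =>
        intro hd
        refine (ih (by omega)).trans ?_
        obtain ⟨M, hM⟩ : ∃ M, k - d = M + 2 + 2 * r := ⟨k - d - 2 - 2 * r, by omega⟩
        have e1 : k - (d + 1) - 1 = M + 2 * r := by omega
        have e2 : k - (d + 1) - r = M + 1 + r := by omega
        have e3 : k - d - 1 = M + 2 * r + 1 := by omega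
        have e4 : k - d - r = M + 2 + r := by omega
        have e5 : n - k + (d + 1) = (n - k + d) + 1 := by omega
        rw [e1, e2, e3, e4, e5, Nat.factorial_succ, Nat.factorial_succ]
        have hle : M + 2 + 2 * r ≤ n - k + d := by omega
        have hpoly : (M + 2 * r + 1) * (M + 2 + r) ≤ (n - k + d + 1) * (M + 1 + r) := by
          nlinarith
        calc _ = (n - k + d)! * (M + 2 * r)! * ((M + 2 * r + 1) * (M + 2 + r)) := by ring
          _ ≤ (n - k + d)! * (M + 2 * r)! * ((n - k + d + 1) * (M + 1 + r)) :=
            Nat.mul_le_mul_left _ hpoly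
          _ = _ := by ring
    have := hstep (k - N) (by omega)
    rwa [show n - k + (k - N) = a by omega, show k - (k - N) = N by omega] at this

/-- A family in which every member has at most `r` proper supersets is, away from the top levels,
hardly larger than an antichain. -/
theorem card_mul_le_of_card_above_le {𝓥 : Finset (Finset X)} (r : ℕ)
    (htop : ∀ A ∈ 𝓥, #A + (2 * r + 2) ≤ Fintype.card X)
    (habove : ∀ A ∈ 𝓥, #{B ∈ 𝓥 | A ⊂ B} ≤ r) :
    #𝓥 * (Fintype.card X / 2 - r) ≤
      Fintype.card X / 2 * (Fintype.card X).choose (Fintype.card X / 2) := by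
  set n := Fintype.card X with hn
  set k := n / 2 with hk
  rcases Nat.eq_zero_or_pos k with hk0 | hk0
  · simp [hk0]
  have hmain := sum_card_prefixed_le 𝓥
  simp only [card_prefixed, ← hn] at hmain
  have h1 : ∀ A ∈ 𝓥, ∑ B ∈ 𝓥 with A ⊂ B, #(prefixed A ∩ prefixed B) ≤
      r * ((#A)! * (n - #A - 1)!) := by
    intro A hA
    calc _ ≤ ∑ B ∈ 𝓥 with A ⊂ B, ((#A)! * (n - #A - 1)!) := by
          refine sum_le_sum fun B hB ↦ ?_
          have hB' := mem_filter.1 hB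
          exact card_prefixed_inter_prefixed_le_left hB'.2 (by have := htop B hB'.1; omega)
      _ ≤ _ := by
          rw [sum_const, smul_eq_mul]
          exact Nat.mul_le_mul_right _ (habove A hA)
  have h2 : ∀ A ∈ 𝓥, (n - k)! * (k - 1)! * (k - r) + r * ((#A)! * (n - #A - 1)!) ≤
      (#A)! * (n - #A)! := by
    intro A hA
    have h3 := htop A hA
    have h4 := factorial_mul_sub_ge r n (#A) (n - #A) (by omega) (by omega)
    obtain ⟨M, hM⟩ : ∃ M, n - #A = M + 1 + r := ⟨n - #A - 1 - r, by omega⟩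
    rw [hM] at h4 ⊢
    rw [show M + 1 + r - 1 = M + r by omega, show M + 1 + r - r = M + 1 by omega] at h4
    rw [show M + 1 + r - 1 = M + r by omega, show M + 1 + r = M + r + 1 by omega,
      Nat.factorial_succ]
    calc _ ≤ (#A)! * (M + r)! * (M + 1) + r * ((#A)! * (M + r)!) := Nat.add_le_add_right h4 _
      _ = _ := by ring
  have h5 : #𝓥 * ((n - k)! * (k - 1)! * (k - r)) ≤ n ! := by
    have h6 := sum_le_sum h2
    rw [sum_add_distrib, sum_const, smul_eq_mul] at h6
    have h7 := sum_le_sum h1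
    omega
  have h8 : n ! = n.choose k * (k * (k - 1)!) * (n - k)! := by
    rw [Nat.mul_factorial_pred hk0.ne',
      Nat.choose_mul_factorial_mul_factorial (Nat.div_le_self n 2)]
  rw [h8] at h5
  refine Nat.le_of_mul_le_mul_right ?_
    (Nat.mul_pos (Nat.factorial_pos (n - k)) (Nat.factorial_pos (k - 1)))
  calc _ = #𝓥 * ((n - k)! * (k - 1)! * (k - r)) := by ring
    _ ≤ _ := h5
    _ = _ := by ring

end ChainCounting

/-! ### Moving antichains to the middle levels -/

section Levels

open Finset
open scoped FinsetFamily

variable {X : Type*} [Fintype X] [DecidableEq X]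

theorem choose_le_choose_of_le_half {n r k : ℕ} (hrk : r ≤ k) (hk : 2 * k ≤ n) :
    n.choose r ≤ n.choose k := by
  induction k, hrk using Nat.le_induction with
  | base => exact le_rfl
  | succ k _ ih => exact (ih (by omega)).trans (Nat.choose_le_succ_of_lt_half_left (by omega))

/-- An antichain living on levels at least `j`, where `j` is at least half the size of the ground
set, can be moved down to level `j`. -/
theorem card_le_card_falling {𝒜 : Finset (Finset X)} {j : ℕ}
    (h𝒜 : IsAntichain (· ⊆ ·) (𝒜 : Set (Finset X))) (hj : Fintype.card X ≤ 2 * j)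
    (hj' : j ≤ Fintype.card X) (hle : ∀ A ∈ 𝒜, j ≤ #A) : #𝒜 ≤ #(falling j 𝒜) := by
  set n := Fintype.card X with hn
  have h := le_card_falling_div_choose (𝕜 := ℚ) (Nat.sub_le n j) h𝒜
  rw [← hn, Nat.sub_sub_self hj'] at h
  have hpos : (0 : ℚ) < n.choose j := by exact_mod_cast Nat.choose_pos hj'
  have h1 : (#𝒜 : ℚ) / n.choose j ≤
      ∑ r ∈ range (n - j + 1), (#(𝒜 # (n - r)) : ℚ) / n.choose (n - r) := by
    have h2 : #𝒜 = ∑ r ∈ range (n - j + 1), #(𝒜 # (n - r)) := by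
      rw [card_eq_sum_card_fiberwise (f := fun A ↦ n - #A) (t := range (n - j + 1))]
      · refine sum_congr rfl fun r hr ↦ ?_
        congr 1
        ext A
        have := card_le_univ A
        simp only [mem_filter, mem_slice]
        simp only [mem_range] at hr
        constructor <;> rintro ⟨h1, h2⟩ <;> exact ⟨h1, by omega⟩
      · intro A hA
        have := hle A hA
        simp only [coe_range, Set.mem_Iio]
        omega
    rw [h2, Nat.cast_sum, sum_div]
    refine sum_le_sum fun r hr ↦ ?_
    have hr' := mem_range.1 hr
    have h3 : n.choose (n - r) ≤ n.choose j := by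
      rw [Nat.choose_symm (by omega), ← Nat.choose_symm hj']
      exact choose_le_choose_of_le_half (by omega) (by omega)
    exact div_le_div_of_nonneg_left (by positivity)
      (by exact_mod_cast Nat.choose_pos (Nat.sub_le n r)) (by exact_mod_cast h3)
  have h4 := h1.trans h
  rw [div_le_div_iff_of_pos_right hpos] at h4
  exact_mod_cast h4

theorem isAntichain_compls {𝒜 : Finset (Finset X)}
    (h𝒜 : IsAntichain (· ⊆ ·) (𝒜 : Set (Finset X))) :
    IsAntichain (· ⊆ ·) (𝒜ᶜˢ : Set (Finset X)) := by
  intro A hA B hB hne hAB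
  rw [mem_coe, mem_compls] at hA hB
  exact hne (compl_injective (h𝒜.eq hB hA (compl_subset_compl.2 hAB)).symm)

/-- An antichain living on levels at most `j`, where `j` is at most half the size of the ground set,
can be moved up to level `j`. -/
theorem exists_card_le_of_isAntichain_low {𝒜 : Finset (Finset X)} {j : ℕ}
    (h𝒜 : IsAntichain (· ⊆ ·) (𝒜 : Set (Finset X))) (hj : 2 * j ≤ Fintype.card X)
    (hle : ∀ A ∈ 𝒜, #A ≤ j) :
    ∃ 𝓑 : Finset (Finset X), #𝒜 ≤ #𝓑 ∧ ∀ B ∈ 𝓑, #B = j ∧ ∃ A ∈ 𝒜, A ⊆ B := by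
  refine ⟨(falling (Fintype.card X - j) 𝒜ᶜˢ)ᶜˢ, ?_, ?_⟩
  · rw [card_compls, ← card_compls 𝒜]
    refine card_le_card_falling (isAntichain_compls h𝒜) (by omega) (by omega) ?_
    intro A hA
    have h1 := hle _ (mem_compls.1 hA)
    rw [card_compl] at h1
    omega
  · intro B hB
    obtain ⟨⟨A, hA, hBA⟩, hc⟩ := mem_falling.1 (mem_compls.1 hB)
    have := card_le_univ B
    rw [card_compl] at hc
    exact ⟨by omega, Aᶜ, mem_compls.1 hA, compl_le_iff_compl_le.1 hBA⟩

/-- A complement-closed antichain on `2 * m + 1` points. Its members of size at most `m` form an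
intersecting family, which moves up to level `m`, where the Erdős–Ko–Rado theorem applies. -/
theorem card_le_of_isAntichain_of_compls_eq {m : ℕ} {𝓗 : Finset (Finset (Fin (2 * m + 1)))}
    (h : IsAntichain (· ⊆ ·) (𝓗 : Set (Finset (Fin (2 * m + 1))))) (hc : 𝓗ᶜˢ = 𝓗) :
    #𝓗 ≤ 2 * (2 * m).choose (m - 1) := by
  set L := {A ∈ 𝓗 | #A ≤ m} with hL
  have hmem : ∀ A, Aᶜ ∈ 𝓗 ↔ A ∈ 𝓗 := fun A ↦ by rw [← mem_compls, hc]
  have hcard : #𝓗 = 2 * #L := by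
    have h1 := card_filter_add_card_filter_not (s := 𝓗) (fun A ↦ #A ≤ m)
    have h2 : {A ∈ 𝓗 | ¬ #A ≤ m} = Lᶜˢ := by
      ext A
      have h3 := card_compl A
      have h4 := card_le_univ A
      simp only [Fintype.card_fin] at h3 h4
      simp only [hL, mem_filter, mem_compls, hmem]
      constructor <;> rintro ⟨h1, h2⟩ <;> exact ⟨h1, by omega⟩
    rw [h2, card_compls] at h1
    change #L + #L = _ at h1
    omega
  obtain ⟨𝓑, hle, h𝓑⟩ := exists_card_le_of_isAntichain_low (𝒜 := L) (j := m)
    (h.subset (coe_subset.2 (filter_subset _ _))) (by simp) (fun A hA ↦ (mem_filter.1 hA).2)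
  have hekr := erdos_ko_rado (𝒜 := 𝓑) (r := m) (by
    intro A hA B hB hAB
    obtain ⟨-, A', hA', hAA⟩ := h𝓑 A hA
    obtain ⟨-, B', hB', hBB⟩ := h𝓑 B hB
    obtain ⟨hA₁, hA₂⟩ := mem_filter.1 hA'
    obtain ⟨hB₁, hB₂⟩ := mem_filter.1 hB'
    have h1 : A' ⊆ B'ᶜ := subset_compl_iff_disjoint_right.2 (hAB.mono hAA hBB)
    have h2 : A' = B'ᶜ := h.eq hA₁ ((hmem B').2 hB₁) h1
    have h3 := card_compl B'
    have h4 := card_le_univ B'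
    simp only [Fintype.card_fin] at h3 h4
    rw [h2] at hA₂
    omega) (fun B hB ↦ (h𝓑 B hB).1) (by omega)
  rw [Nat.add_sub_cancel] at hekr
  omega

end Levels

/-! ### Arcs of a cyclic order -/

section Arcs

open Finset Numbering
open scoped Nat FinsetFamily

/-- A nonempty set of positions on a circle closed under moving back by one is everything. -/
theorem eq_univ_of_forall_sub_one_mem {n : ℕ} [NeZero n] {S : Finset (Fin n)} (hS : S.Nonempty)
    (h : ∀ i ∈ S, i - 1 ∈ S) : S = univ := by
  obtain ⟨i, hi⟩ := hS
  have key : ∀ k : ℕ, ∀ j : Fin n, (i - j).val = k → j ∈ S := by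
    intro k
    induction k with
    | zero =>
      intro j hj
      have h0 : i - j = 0 := Fin.ext (by simpa using hj)
      rwa [← sub_eq_zero.1 h0]
    | succ k ih =>
      intro j hj
      have h1 : (i - (j + 1)).val = k := by
        rw [← sub_sub, Fin.val_sub_one_of_ne_zero, hj, Nat.add_sub_cancel]
        intro h0
        rw [h0] at hj
        simp at hj
      have h2 := h _ (ih _ h1)
      rwa [add_sub_cancel_right] at h2
  exact eq_univ_iff_forall.2 fun j ↦ key _ j rfl

theorem card_add_one_le_card_union_image_sub_one {n : ℕ} [NeZero n] {S : Finset (Fin n)}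
    (hS : S.Nonempty) (hS' : S ≠ univ) : #S + 1 ≤ #(S ∪ S.image (· - 1)) := by
  refine card_lt_card ((subset_union_left).ssubset_of_ne fun heq ↦ hS' ?_)
  refine eq_univ_of_forall_sub_one_mem hS fun i hi ↦ ?_
  rw [heq]
  exact mem_union_right _ (mem_image_of_mem _ hi)

theorem card_add_one_le_card_union_image_add_one {n : ℕ} [NeZero n] {S : Finset (Fin n)}
    (hS : S.Nonempty) (hS' : S ≠ univ) : #S + 1 ≤ #(S ∪ S.image (· + 1)) := by
  refine card_lt_card ((subset_union_left).ssubset_of_ne fun heq ↦ hS' ?_)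
  have h1 : Sᶜ = ∅ := by
    by_contra hne
    have h2 := eq_univ_of_forall_sub_one_mem (nonempty_iff_ne_empty.2 hne) fun i hi ↦ ?_
    · rw [compl_eq_univ_iff] at h2
      exact hS.ne_empty h2
    · rw [mem_compl] at hi ⊢
      intro hi'
      apply hi
      rw [heq]
      exact mem_union_right _ (mem_image.2 ⟨_, hi', sub_add_cancel _ _⟩)
  simpa using h1

variable {X : Type*} [Fintype X]

/-- The arc of the `k` elements that are placed at the positions `i, …, i + k - 1` when the ground
set is arranged on a circle according to the numbering `f`. -/
def arc [NeZero (Fintype.card X)] (f : Numbering X) (i : Fin (Fintype.card X)) (k : ℕ) :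
    Finset X :=
  {x | (f x - i).val < k}

variable [NeZero (Fintype.card X)]

theorem mem_arc {f : Numbering X} {i : Fin (Fintype.card X)} {k : ℕ} {x : X} :
    x ∈ arc f i k ↔ (f x - i).val < k := by
  simp [arc]

theorem arc_subset_arc_succ (f : Numbering X) (i : Fin (Fintype.card X)) (k : ℕ) :
    arc f i k ⊆ arc f i (k + 1) := fun x hx ↦ by
  rw [mem_arc] at hx ⊢
  omega

theorem arc_subset_arc_sub_one (f : Numbering X) (i : Fin (Fintype.card X)) (k : ℕ) :
    arc f i k ⊆ arc f (i - 1) (k + 1) := fun x hx ↦ by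
  rw [mem_arc] at hx ⊢
  have h1 : f x - (i - 1) = f x - i + 1 := by abel
  rw [h1, Fin.val_add]
  refine (Nat.mod_le _ _).trans_lt ?_
  have h2 : (1 : Fin (Fintype.card X)).val ≤ 1 := by
    rw [Fin.val_one']
    exact Nat.mod_le _ _
  omega

theorem isPrefix_iff_arc_zero_eq {f : Numbering X} {A : Finset X} :
    IsPrefix f A ↔ arc f 0 (#A) = A := by
  simp only [Finset.ext_iff, mem_arc, sub_zero, IsPrefix]
  exact forall_congr' fun x ↦ Iff.comm

variable [DecidableEq X]

theorem arc_add_half {m : ℕ} (hX : Fintype.card X = 2 * m) (hm : m < Fintype.card X)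
    (f : Numbering X) (i : Fin (Fintype.card X)) :
    arc f (i + ⟨m, hm⟩) m = (arc f i m)ᶜ := by
  ext x
  rw [mem_compl, mem_arc, mem_arc, ← sub_sub]
  generalize f x - i = y
  have hy := y.2
  rw [Fin.sub_def]
  simp only
  rcases Nat.lt_or_ge y.val m with h | h
  · rw [Nat.mod_eq_of_lt (by omega)]
    omega
  · rw [show Fintype.card X - m + y.val = (y.val - m) + Fintype.card X by omega,
      Nat.add_mod_right, Nat.mod_eq_of_lt (by omega)]
    omega

/-- Over all numberings, each arc position is equally likely to carry any set of the right size. -/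
theorem sum_card_arc_mem {𝒜 : Finset (Finset X)} {k : ℕ} (h𝒜 : ∀ A ∈ 𝒜, #A = k) :
    ∑ f : Numbering X, #{i | arc f i k ∈ 𝒜} =
      Fintype.card X * (#𝒜 * (k ! * (Fintype.card X - k)!)) := by
  have h0 : #{f : Numbering X | arc f 0 k ∈ 𝒜} = #𝒜 * (k ! * (Fintype.card X - k)!) := by
    have h1 : ({f : Numbering X | arc f 0 k ∈ 𝒜} : Finset _) = 𝒜.biUnion prefixed := by
      ext f
      simp only [mem_filter, mem_univ, true_and, mem_biUnion, mem_prefixed,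
        isPrefix_iff_arc_zero_eq]
      constructor
      · exact fun hf ↦ ⟨_, hf, by rw [h𝒜 _ hf]⟩
      · rintro ⟨A, hA, hfA⟩
        rw [h𝒜 _ hA] at hfA
        rwa [hfA]
    rw [h1, card_biUnion, sum_congr rfl fun A hA ↦ by rw [card_prefixed, h𝒜 A hA], sum_const,
      smul_eq_mul]
    intro A hA B hB hne
    rw [Function.onFun, disjoint_left]
    intro f hfA hfB
    rw [mem_prefixed, isPrefix_iff_arc_zero_eq] at hfA hfB
    rw [h𝒜 A hA] at hfA
    rw [h𝒜 B hB] at hfB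
    exact hne (hfA.symm.trans hfB)
  calc _ = ∑ i : Fin (Fintype.card X), #{f : Numbering X | arc f i k ∈ 𝒜} := by
        simp only [card_filter]
        rw [sum_comm]
    _ = ∑ i : Fin (Fintype.card X), #{f : Numbering X | arc f 0 k ∈ 𝒜} := by
        refine sum_congr rfl fun i _ ↦ ?_
        -- rotating the numbering by `i` takes the arc at `i` to the arc at `0`
        refine card_bij' (fun f _ ↦ f.trans (Equiv.subRight i))
          (fun f _ ↦ f.trans (Equiv.addRight i)) ?_ ?_ ?_ ?_
        · intro f hf
          rw [mem_filter] at hf ⊢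
          simpa [arc] using hf
        · intro f hf
          rw [mem_filter] at hf ⊢
          simpa [arc] using hf
        · intro f _
          ext x
          simp
        · intro f _
          ext x
          simp
    _ = _ := by
        rw [sum_const, card_univ, Fintype.card_fin, smul_eq_mul, h0]

/-- Katona's circle method for families on the three middle levels. The weights `m` and `m + 1`
are proportional to the reciprocals of the numbers of cyclic orders in which a set of size `m ± 1`,
respectively `m`, is an arc. -/
theorem arc_count_le {m : ℕ} (hm : 0 < m) (hX : Fintype.card X = 2 * m)
    {L M U : Finset (Finset X)}
    (hLM : ∀ A ∈ L, ∀ B ∈ M, ¬ A ⊆ B) (hMU : ∀ B ∈ M, ∀ C ∈ U, ¬ B ⊆ C)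
    (hLU : ∀ A ∈ L, ∀ C ∈ U, ¬ A ⊆ C) (hM : ∀ B ∈ M, Bᶜ ∉ M) (f : Numbering X) :
    m * (#{i | arc f i (m - 1) ∈ L} + #{i | arc f i (m + 1) ∈ U}) +
      (m + 1) * #{i | arc f i m ∈ M} ≤ m * (2 * m) := by
  set S : Finset (Fin (Fintype.card X)) := {i | arc f i (m - 1) ∈ L} with hS
  set T : Finset (Fin (Fintype.card X)) := {i | arc f i (m + 1) ∈ U} with hT
  set R : Finset (Fin (Fintype.card X)) := {i | arc f i m ∈ M} with hR
  have hSmem : ∀ i, i ∈ S ↔ arc f i (m - 1) ∈ L := by simp [hS]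
  have hTmem : ∀ i, i ∈ T ↔ arc f i (m + 1) ∈ U := by simp [hT]
  have hRmem : ∀ i, i ∈ R ↔ arc f i m ∈ M := by simp [hR]
  have hQS : ∀ j ∈ S ∪ S.image (· - 1), ∃ A ∈ L, A ⊆ arc f j m := by
    intro j hj
    obtain hj | hj := mem_union.1 hj
    · refine ⟨_, (hSmem j).1 hj, ?_⟩
      have := arc_subset_arc_succ f j (m - 1)
      rwa [Nat.sub_add_cancel hm] at this
    · obtain ⟨i, hi, rfl⟩ := mem_image.1 hj
      refine ⟨_, (hSmem i).1 hi, ?_⟩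
      have := arc_subset_arc_sub_one f i (m - 1)
      rwa [Nat.sub_add_cancel hm] at this
  have hQT : ∀ j ∈ T ∪ T.image (· + 1), ∃ C ∈ U, arc f j m ⊆ C := by
    intro j hj
    obtain hj | hj := mem_union.1 hj
    · exact ⟨_, (hTmem j).1 hj, arc_subset_arc_succ f j m⟩
    · obtain ⟨i, hi, rfl⟩ := mem_image.1 hj
      refine ⟨_, (hTmem i).1 hi, ?_⟩
      simpa using arc_subset_arc_sub_one f (i + 1) m
  have hd1 : Disjoint (S ∪ S.image (· - 1)) (T ∪ T.image (· + 1)) := by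
    rw [disjoint_left]
    intro j hj hj'
    obtain ⟨A, hA, hAj⟩ := hQS j hj
    obtain ⟨C, hC, hCj⟩ := hQT j hj'
    exact hLU A hA C hC (hAj.trans hCj)
  have hd2 : Disjoint ((S ∪ S.image (· - 1)) ∪ (T ∪ T.image (· + 1))) R := by
    rw [disjoint_left]
    intro j hj hjR
    rw [hRmem] at hjR
    obtain hj | hj := mem_union.1 hj
    · obtain ⟨A, hA, hAj⟩ := hQS j hj
      exact hLM A hA _ hjR hAj
    · obtain ⟨C, hC, hCj⟩ := hQT j hj
      exact hMU _ hjR C hC hCj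
  have hq : #(S ∪ S.image (· - 1)) + #(T ∪ T.image (· + 1)) + #R ≤ 2 * m := by
    rw [← card_union_of_disjoint hd1, ← card_union_of_disjoint hd2, ← hX]
    simpa using card_le_univ ((S ∪ S.image (· - 1)) ∪ (T ∪ T.image (· + 1)) ∪ R)
  have hRm : #R ≤ m := by
    have hmX : m < Fintype.card X := by omega
    have hd3 : Disjoint R (R.image (· + ⟨m, hmX⟩)) := by
      rw [disjoint_left]
      intro j hj hj'
      obtain ⟨i, hi, rfl⟩ := mem_image.1 hj'
      rw [hRmem] at hi hj
      rw [arc_add_half hX] at hj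
      exact hM _ hi hj
    have h1 := card_le_univ (R ∪ R.image (· + ⟨m, hmX⟩))
    rw [card_union_of_disjoint hd3, card_image_of_injective _ (add_left_injective _),
      Fintype.card_fin] at h1
    omega
  have hSle : #S ≤ #(S ∪ S.image (· - 1)) := card_le_card subset_union_left
  have hTle : #T ≤ #(T ∪ T.image (· + 1)) := card_le_card subset_union_left
  have hSuniv : S = univ → #S = 2 * m := by rintro h; simp [h, hX]
  have hTuniv : T = univ → #T = 2 * m := by rintro h; simp [h, hX]
  -- if all arcs of one of the outer levels are present, nothing else is
  by_cases hfull : #S + #T = 2 * m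
  · have : #R = 0 := by omega
    rw [hfull, this]
    simp
  by_cases hzero : #S + #T = 0
  · rw [hzero]
    nlinarith
  have hp : #S + #T + 1 ≤ #(S ∪ S.image (· - 1)) + #(T ∪ T.image (· + 1)) := by
    rcases S.eq_empty_or_nonempty with h0 | h0
    · have hT0 : T.Nonempty := by
        rw [← card_pos]
        simp only [h0, card_empty, zero_add] at hzero
        omega
      have := card_add_one_le_card_union_image_add_one hT0 (fun h ↦ by
        have := hTuniv h
        omega)
      omega
    · have := card_add_one_le_card_union_image_sub_one h0 (fun h ↦ by
        have := hSuniv h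
        omega)
      omega
  generalize #S + #T = p at *
  rcases Nat.lt_or_ge p m with hpm | hpm
  · nlinarith
  · have h1 : #R ≤ 2 * m - (p + 1) := by omega
    obtain ⟨d, hd⟩ : ∃ d, 2 * m = p + 1 + d := ⟨2 * m - (p + 1), by omega⟩
    have h2 : #R ≤ d := by omega
    nlinarith

theorem card_add_card_add_card_le_choose {m : ℕ} (hm : 0 < m) (hX : Fintype.card X = 2 * m)
    {L M U : Finset (Finset X)} (hL : ∀ A ∈ L, #A = m - 1) (hM : ∀ A ∈ M, #A = m)
    (hU : ∀ A ∈ U, #A = m + 1)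
    (hLM : ∀ A ∈ L, ∀ B ∈ M, ¬ A ⊆ B) (hMU : ∀ B ∈ M, ∀ C ∈ U, ¬ B ⊆ C)
    (hLU : ∀ A ∈ L, ∀ C ∈ U, ¬ A ⊆ C) (hMc : ∀ B ∈ M, Bᶜ ∉ M) :
    #L + #M + #U ≤ (2 * m).choose (m - 1) := by
  have h1 := sum_le_sum fun (f : Numbering X) (_ : f ∈ univ) ↦
    arc_count_le hm hX hLM hMU hLU hMc f
  rw [sum_add_distrib, ← mul_sum, ← mul_sum, sum_add_distrib, sum_card_arc_mem hL,
    sum_card_arc_mem hM, sum_card_arc_mem hU, sum_const, card_univ, Fintype.card_numbering,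
    smul_eq_mul, hX] at h1
  have h2 := Nat.choose_mul_factorial_mul_factorial (show m - 1 ≤ 2 * m by omega)
  obtain ⟨k, rfl⟩ : ∃ k, m = k + 1 := ⟨m - 1, by omega⟩
  rw [← h2] at h1
  rw [show k + 1 - 1 = k by omega, show 2 * (k + 1) - k = k + 2 by omega,
    show 2 * (k + 1) - (k + 1) = k + 1 by omega, show 2 * (k + 1) - (k + 1 + 1) = k by omega] at h1
  rw [show k + 1 - 1 = k by omega]
  have h3 : (k + 1)! = (k + 1) * k ! := Nat.factorial_succ k
  have h4 : (k + 2)! = (k + 2) * (k + 1)! := Nat.factorial_succ (k + 1)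
  rw [show k + 1 + 1 = k + 2 by omega, h4, h3] at h1
  have hk := Nat.factorial_pos k
  refine Nat.le_of_mul_le_mul_left ?_
    (show 0 < 2 * (k + 1) * (k + 1) * (k + 2) * (k + 1) * (k ! * k !) by positivity)
  calc _ = _ := ?_
    _ ≤ _ := h1
    _ = _ := ?_
  · ring
  · ring

/-- An antichain on `2 * m` points without two complementary members is at most as large as level
`m - 1`. -/
theorem card_le_of_isAntichain_of_compl_notMem {m : ℕ} (hm : 0 < m) (hX : Fintype.card X = 2 * m)
    {𝒜 : Finset (Finset X)} (h𝒜 : IsAntichain (· ⊆ ·) (𝒜 : Set (Finset X)))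
    (hc : ∀ A ∈ 𝒜, Aᶜ ∉ 𝒜) : #𝒜 ≤ (2 * m).choose (m - 1) := by
  obtain ⟨L, hLle, hL⟩ := exists_card_le_of_isAntichain_low (𝒜 := {A ∈ 𝒜 | #A < m}) (j := m - 1)
    (h𝒜.subset (coe_subset.2 (filter_subset _ _))) (by omega)
    (fun A hA ↦ by have := (mem_filter.1 hA).2; omega)
  set U := falling (m + 1) {A ∈ 𝒜 | m < #A} with hUdef
  have hUle : #{A ∈ 𝒜 | m < #A} ≤ #U :=
    card_le_card_falling (h𝒜.subset (coe_subset.2 (filter_subset _ _))) (by omega) (by omega)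
      (fun A hA ↦ (mem_filter.1 hA).2)
  have hU : ∀ C ∈ U, #C = m + 1 ∧ ∃ D ∈ 𝒜, m < #D ∧ C ⊆ D := by
    intro C hC
    obtain ⟨⟨D, hD, hCD⟩, hc⟩ := mem_falling.1 hC
    obtain ⟨h1, h2⟩ := mem_filter.1 hD
    exact ⟨hc, D, h1, h2, hCD⟩
  have hL' : ∀ A ∈ L, ∃ D ∈ 𝒜, #D < m ∧ D ⊆ A := by
    intro A hA
    obtain ⟨-, D, hD, hDA⟩ := hL A hA
    obtain ⟨h1, h2⟩ := mem_filter.1 hD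
    exact ⟨D, h1, h2, hDA⟩
  have hmain := card_add_card_add_card_le_choose hm hX (L := L) (M := {A ∈ 𝒜 | #A = m}) (U := U)
    (fun A hA ↦ (hL A hA).1) (fun A hA ↦ (mem_filter.1 hA).2) (fun A hA ↦ (hU A hA).1)
    (by
      intro A hA B hB hAB
      obtain ⟨D, hD, hDm, hDA⟩ := hL' A hA
      obtain ⟨hB₁, hB₂⟩ := mem_filter.1 hB
      have := h𝒜.eq hD hB₁ (hDA.trans hAB)
      subst this
      omega)
    (by
      intro B hB C hC hBC
      obtain ⟨-, D, hD, hDm, hCD⟩ := hU C hC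
      obtain ⟨hB₁, hB₂⟩ := mem_filter.1 hB
      have := h𝒜.eq hB₁ hD (hBC.trans hCD)
      subst this
      omega)
    (by
      intro A hA C hC hAC
      obtain ⟨D, hD, hDm, hDA⟩ := hL' A hA
      obtain ⟨-, E, hE, hEm, hCE⟩ := hU C hC
      have := h𝒜.eq hD hE (hDA.trans (hAC.trans hCE))
      subst this
      omega)
    (by
      intro B hB hB'
      exact hc B (mem_filter.1 hB).1 (mem_filter.1 hB').1)
  have hsplit : #𝒜 = #{A ∈ 𝒜 | #A < m} + #{A ∈ 𝒜 | #A = m} + #{A ∈ 𝒜 | m < #A} := by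
    rw [← card_union_of_disjoint, ← card_union_of_disjoint]
    · congr 1
      ext A
      simp only [mem_union, mem_filter, ← and_or_left]
      have : #A < m ∨ #A = m ∨ m < #A := lt_trichotomy _ _
      tauto
    · rw [disjoint_left]
      intro A hA hA'
      simp only [mem_union, mem_filter, ← and_or_left] at hA hA'
      omega
    · rw [disjoint_left]
      intro A hA hA'
      simp only [mem_filter] at hA hA'
      omega
  omega

end Arcs

/-! ### Families without chains of three members -/

section ChainFree

open Finset
open scoped FinsetFamily

variable {X : Type*} [DecidableEq X] {𝓗 : Finset (Finset X)}

theorem isAntichain_filter_below_eq_zero (𝓗 : Finset (Finset X)) :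
    IsAntichain (· ⊆ ·) ({B ∈ 𝓗 | #{A ∈ 𝓗 | A ⊂ B} = 0} : Set (Finset X)) := by
  rintro A ⟨hA, -⟩ B ⟨-, hB⟩ hne hAB
  rw [card_eq_zero, filter_eq_empty_iff] at hB
  exact hB hA (hAB.ssubset_of_ne hne)

theorem isAntichain_filter_above_eq_zero (𝓗 : Finset (Finset X)) :
    IsAntichain (· ⊆ ·) ({B ∈ 𝓗 | #{C ∈ 𝓗 | B ⊂ C} = 0} : Set (Finset X)) := by
  rintro A ⟨-, hA⟩ B ⟨hB, -⟩ hne hAB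
  rw [card_eq_zero, filter_eq_empty_iff] at hA
  exact hA hB (hAB.ssubset_of_ne hne)

variable [Fintype X]

/-- Erdős's bound for families without chains of three members: the minimal members and the maximal
members form antichains. -/
theorem card_le_two_mul_choose_half
    (h : ∀ B ∈ 𝓗, #{A ∈ 𝓗 | A ⊂ B} = 0 ∨ #{C ∈ 𝓗 | B ⊂ C} = 0) :
    #𝓗 ≤ 2 * (Fintype.card X).choose (Fintype.card X / 2) := by
  have h1 : #{B ∈ 𝓗 | #{A ∈ 𝓗 | A ⊂ B} = 0} ≤ _ :=
    IsAntichain.sperner (by simpa using isAntichain_filter_below_eq_zero 𝓗)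
  have h2 : #{B ∈ 𝓗 | #{C ∈ 𝓗 | B ⊂ C} = 0} ≤ _ :=
    IsAntichain.sperner (by simpa using isAntichain_filter_above_eq_zero 𝓗)
  have h3 : 𝓗 ⊆ {B ∈ 𝓗 | #{A ∈ 𝓗 | A ⊂ B} = 0} ∪ {B ∈ 𝓗 | #{C ∈ 𝓗 | B ⊂ C} = 0} := by
    intro B hB
    rw [mem_union, mem_filter, mem_filter]
    exact (h B hB).imp (fun h ↦ ⟨hB, h⟩) (fun h ↦ ⟨hB, h⟩)
  have h4 := (card_le_card h3).trans (card_union_le _ _)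
  omega

/-- For a complement-closed family on `2 * m` points the bound for families without chains of three
members improves. Every complementary pair contains a minimal member, and choosing one from each
pair leaves an antichain without complementary members. -/
theorem card_le_two_mul_choose_of_compls_eq {m : ℕ} (hm : 0 < m) (hX : Fintype.card X = 2 * m)
    (hc : 𝓗ᶜˢ = 𝓗) (h : ∀ B ∈ 𝓗, #{A ∈ 𝓗 | A ⊂ B} = 0 ∨ #{C ∈ 𝓗 | B ⊂ C} = 0) :
    #𝓗 ≤ 2 * (2 * m).choose (m - 1) := by
  have hmem : ∀ A, Aᶜ ∈ 𝓗 ↔ A ∈ 𝓗 := fun A ↦ by rw [← mem_compls, hc]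
  obtain ⟨x⟩ : Nonempty X := Fintype.card_pos_iff.1 (by omega)
  have : NeZero (Fintype.card X) := ⟨by omega⟩
  set 𝒜 := {B ∈ 𝓗 | #{A ∈ 𝓗 | A ⊂ B} = 0} with h𝒜
  have hanti : IsAntichain (· ⊆ ·) (𝒜 : Set (Finset X)) := by
    simpa [h𝒜] using isAntichain_filter_below_eq_zero 𝓗
  have hmin : ∀ A ∈ 𝓗, A ∈ 𝒜 ∨ Aᶜ ∈ 𝒜 := by
    intro A hA
    refine (h A hA).imp (fun h ↦ mem_filter.2 ⟨hA, h⟩)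
      (fun h ↦ mem_filter.2 ⟨(hmem A).2 hA, ?_⟩)
    rw [card_eq_zero, filter_eq_empty_iff] at h ⊢
    intro B hB hBA
    exact h ((hmem B).2 hB) (by
      have := compl_lt_compl_iff_lt.2 (show B < Aᶜ from hBA)
      rwa [compl_compl] at this)
  set 𝓑 := {A ∈ 𝒜 | Aᶜ ∉ 𝒜 ∨ x ∈ A} with h𝓑
  have h1 : #𝓑 ≤ (2 * m).choose (m - 1) :=
    card_le_of_isAntichain_of_compl_notMem hm hX
      (hanti.subset (coe_subset.2 (filter_subset _ _))) (by
      intro A hA hA'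
      simp only [h𝓑, mem_filter, compl_compl, mem_compl] at hA hA'
      tauto)
  have h2 : 𝓗 ⊆ 𝓑 ∪ 𝓑ᶜˢ := by
    intro A hA
    have := hmin A hA
    simp only [h𝓑, mem_union, mem_compls, mem_filter, compl_compl, mem_compl]
    tauto
  have h3 := (card_le_card h2).trans (card_union_le _ _)
  rw [card_compls] at h3
  omega

end ChainFree

/-! ### Upper bounds for small parameters -/

section UpperBounds

open Finset
open scoped FinsetFamily

variable {n : ℕ}

theorem compls_inter_compls_self (𝓕 : Finset (Finset (Fin n))) :
    (𝓕 ∩ 𝓕ᶜˢ)ᶜˢ = 𝓕 ∩ 𝓕ᶜˢ := by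
  rw [compls_inter, compls_compls, inter_comm]

theorem maxUnionIntersecting_one_one_le (hn : 0 < n) :
    2 * maxUnionIntersecting n 1 1 ≤ 2 ^ n := by
  obtain ⟨𝓕, h, hcard⟩ := exists_card_eq_maxUnionIntersecting n 1 1 (by norm_num)
  rw [← hcard]
  have h2n : 2 ^ 1 ≤ 2 ^ n := Nat.pow_le_pow_right two_pos hn
  by_cases he : ∅ ∈ 𝓕
  · have := h.card_le_of_empty_mem he
    omega
  have h0 : 𝓕 ∩ 𝓕ᶜˢ = ∅ := by
    by_contra hne
    obtain ⟨B, hB⟩ := nonempty_iff_ne_empty.2 hne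
    have := h.card_below_or_card_above Subset.rfl (fun h ↦ he (mem_inter.1 h).1) hB
    omega
  have := two_mul_card_le_add_card_inter_compls 𝓕
  rw [h0, card_empty] at this
  omega

theorem UnionIntersecting.card_above_lt {t : ℕ} {𝓕 𝓗 : Finset (Finset (Fin n))}
    (h : UnionIntersecting 1 t 𝓕) (h𝓗 : 𝓗 ⊆ 𝓕 ∩ 𝓕ᶜˢ) (he : ∅ ∉ 𝓗) {B : Finset (Fin n)}
    (hB : B ∈ 𝓗) : #{C ∈ 𝓗 | B ⊂ C} + 1 < t := by
  have := h.card_below_or_card_above h𝓗 he hB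
  omega

theorem UnionIntersecting.card_below_lt {t : ℕ} {𝓕 𝓗 : Finset (Finset (Fin n))}
    (h : UnionIntersecting 1 t 𝓕) (h𝓗 : 𝓗 ⊆ 𝓕 ∩ 𝓕ᶜˢ) (he : ∅ ∉ 𝓗) {B : Finset (Fin n)}
    (hB : B ∈ 𝓗) : #{A ∈ 𝓗 | A ⊂ B} + 1 < t := by
  have := h.symm.card_below_or_card_above h𝓗 he hB
  omega

theorem maxUnionIntersecting_one_two_le (m : ℕ) (hm : 0 < m) :
    2 * maxUnionIntersecting (2 * m + 1) 1 2 ≤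
      2 ^ (2 * m + 1) + 2 * (2 * m).choose (m - 1) := by
  obtain ⟨𝓕, h, hcard⟩ := exists_card_eq_maxUnionIntersecting (2 * m + 1) 1 2 (by norm_num)
  rw [← hcard]
  have h2n : 2 ^ 3 ≤ 2 ^ (2 * m + 1) := Nat.pow_le_pow_right two_pos (by omega)
  by_cases he : ∅ ∈ 𝓕
  · have := h.card_le_of_empty_mem he
    omega
  have hanti : IsAntichain (· ⊆ ·) ((𝓕 ∩ 𝓕ᶜˢ : Finset _) : Set (Finset (Fin (2 * m + 1)))) := by
    refine (isAntichain_filter_above_eq_zero (𝓕 ∩ 𝓕ᶜˢ)).subset fun B hB ↦ ⟨hB, ?_⟩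
    have := h.card_above_lt Subset.rfl (fun h ↦ he (mem_inter.1 h).1) (mem_coe.1 hB)
    omega
  have h1 := card_le_of_isAntichain_of_compls_eq hanti (compls_inter_compls_self 𝓕)
  have h2 := two_mul_card_le_add_card_inter_compls 𝓕
  omega

theorem maxUnionIntersecting_one_three_le (hn : 3 ≤ n) :
    2 * maxUnionIntersecting n 1 3 ≤ 2 ^ n + 2 * (n - 1).choose ((n - 1) / 2) := by
  obtain ⟨𝓕, h, hcard⟩ := exists_card_eq_maxUnionIntersecting n 1 3 (by norm_num)
  rw [← hcard]
  have h2n : 2 ^ 3 ≤ 2 ^ n := Nat.pow_le_pow_right two_pos hn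
  by_cases he : ∅ ∈ 𝓕
  · have := h.card_le_of_empty_mem he
    omega
  have he' : ∅ ∉ 𝓕 ∩ 𝓕ᶜˢ := fun h ↦ he (mem_inter.1 h).1
  have h1 := card_le_of_comparable_le_one (𝓗 := 𝓕 ∩ 𝓕ᶜˢ) (by simp; omega) he' (by
    intro B hB
    have h1 := h.card_above_lt Subset.rfl he' hB
    have h2 := h.card_below_lt Subset.rfl he' hB
    by_contra! hcon
    -- a member below `B` would have two members above it
    obtain ⟨A, hA⟩ := card_pos.1 (show 0 < #{A ∈ 𝓕 ∩ 𝓕ᶜˢ | A ⊂ B} by omega)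
    obtain ⟨C, hC⟩ := card_pos.1 (show 0 < #{C ∈ 𝓕 ∩ 𝓕ᶜˢ | B ⊂ C} by omega)
    obtain ⟨hA, hAB⟩ := mem_filter.1 hA
    obtain ⟨hC, hBC⟩ := mem_filter.1 hC
    have h3 := h.card_above_lt Subset.rfl he' hA
    have h4 : 1 < #{C ∈ 𝓕 ∩ 𝓕ᶜˢ | A ⊂ C} :=
      one_lt_card.2 ⟨B, mem_filter.2 ⟨hB, hAB⟩, C, mem_filter.2 ⟨hC, hAB.trans hBC⟩, hBC.ne⟩
    omega)
  rw [Fintype.card_fin] at h1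
  have h2 := two_mul_card_le_add_card_inter_compls 𝓕
  omega

theorem two_mul_choose_two_mul_sub_one {m : ℕ} (hm : 0 < m) :
    2 * (2 * m - 1).choose (m - 1) = (2 * m).choose m := by
  obtain ⟨m, rfl⟩ := Nat.exists_eq_succ_of_ne_zero hm.ne'
  rw [Nat.succ_sub_one, Nat.succ_eq_add_one, show 2 * (m + 1) - 1 = 2 * m + 1 by omega,
    show 2 * (m + 1) = 2 * m + 1 + 1 by ring, Nat.choose_succ_succ, Nat.choose_symm_half]
  omega

theorem choose_two_mul_sub_one {m : ℕ} (hm : 2 ≤ m) :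
    (2 * m).choose (m - 1) = (2 * m - 1).choose (m - 2) + (2 * m - 1).choose (m - 1) := by
  obtain ⟨k, rfl⟩ : ∃ k, m = k + 2 := ⟨m - 2, by omega⟩
  rw [show 2 * (k + 2) = 2 * k + 3 + 1 by ring, show k + 2 - 1 = k + 1 by omega,
    Nat.choose_succ_succ, Nat.add_sub_cancel, Nat.add_sub_cancel]

theorem maxUnionIntersecting_one_three_even_le (m : ℕ) (hm : 2 ≤ m) :
    2 * maxUnionIntersecting (2 * m) 1 3 ≤ 2 ^ (2 * m) + (2 * m).choose m := by
  have := maxUnionIntersecting_one_three_le (n := 2 * m) (by omega)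
  rwa [show (2 * m - 1) / 2 = m - 1 by omega, two_mul_choose_two_mul_sub_one (by omega)] at this

theorem maxUnionIntersecting_one_three_odd_le (m : ℕ) (hm : 0 < m) :
    2 * maxUnionIntersecting (2 * m + 1) 1 3 ≤ 2 ^ (2 * m + 1) + 2 * (2 * m).choose m := by
  have := maxUnionIntersecting_one_three_le (n := 2 * m + 1) (by omega)
  rwa [Nat.add_sub_cancel, Nat.mul_div_cancel_left _ two_pos] at this

/-- Removing the empty set from a `(2,2)`-union-intersecting family leaves a
`(1,2)`-union-intersecting one. -/
theorem UnionIntersecting.card_le_of_empty_mem_two_two {𝓕 : Finset (Finset (Fin n))}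
    (h : UnionIntersecting 2 2 𝓕) (he : ∅ ∈ 𝓕) : #𝓕 ≤ maxUnionIntersecting n 1 2 + 1 := by
  have h1 := (UnionIntersecting.erase_empty h he).card_le_max
  rw [card_erase_of_mem he] at h1
  omega

theorem maxUnionIntersecting_two_two_odd_le (m : ℕ) (hm : 0 < m) :
    2 * maxUnionIntersecting (2 * m + 1) 2 2 ≤
      2 ^ (2 * m + 1) + 2 * (2 * m + 1).choose m := by
  obtain ⟨𝓕, h, hcard⟩ := exists_card_eq_maxUnionIntersecting (2 * m + 1) 2 2 (by norm_num)
  rw [← hcard]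
  by_cases he : ∅ ∈ 𝓕
  · have h1 := h.card_le_of_empty_mem_two_two he
    have h2 := maxUnionIntersecting_one_two_le m hm
    have h3 : (2 * m + 1).choose m = (2 * m).choose (m - 1) + (2 * m).choose m := by
      obtain ⟨k, rfl⟩ := Nat.exists_eq_succ_of_ne_zero hm.ne'
      rw [Nat.choose_succ_succ, Nat.succ_sub_one]
    have h4 : 0 < (2 * m).choose m := Nat.choose_pos (by omega)
    omega
  have h1 := card_le_two_mul_choose_half (𝓗 := 𝓕 ∩ 𝓕ᶜˢ) (fun B hB ↦ by
    have := h.card_below_or_card_above Subset.rfl (fun h ↦ he (mem_inter.1 h).1) hB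
    omega)
  rw [Fintype.card_fin, show (2 * m + 1) / 2 = m by omega] at h1
  have h2 := two_mul_card_le_add_card_inter_compls 𝓕
  omega

theorem maxUnionIntersecting_two_two_even_le (m : ℕ) (hm : 2 ≤ m) :
    2 * maxUnionIntersecting (2 * m) 2 2 ≤ 2 ^ (2 * m) + 2 * (2 * m).choose (m - 1) := by
  obtain ⟨𝓕, h, hcard⟩ := exists_card_eq_maxUnionIntersecting (2 * m) 2 2 (by norm_num)
  rw [← hcard]
  by_cases he : ∅ ∈ 𝓕
  · have h1 := h.card_le_of_empty_mem_two_two he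
    have h2 := maxUnionIntersecting_one_three_even_le m hm
    have h3 : maxUnionIntersecting (2 * m) 1 2 ≤ maxUnionIntersecting (2 * m) 1 3 :=
      maxUnionIntersecting_mono (by norm_num) le_rfl (by norm_num)
    have h4 := two_mul_choose_two_mul_sub_one (show 0 < m by omega)
    have h5 := choose_two_mul_sub_one hm
    have h6 : 0 < (2 * m - 1).choose (m - 2) := Nat.choose_pos (by omega)
    omega
  have h1 := card_le_two_mul_choose_of_compls_eq (𝓗 := 𝓕 ∩ 𝓕ᶜˢ) (show 0 < m by omega) (by simp)
    (compls_inter_compls_self 𝓕) (fun B hB ↦ by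
      have := h.card_below_or_card_above Subset.rfl (fun h ↦ he (mem_inter.1 h).1) hB
      omega)
  have h2 := two_mul_card_le_add_card_inter_compls 𝓕
  omega

end UpperBounds

/-! ### Extremal families -/

section Constructions

open Finset
open scoped FinsetFamily

/-- The family of all subsets of an `n`-element set with at least `k` elements. -/
def upperLevels (n k : ℕ) : Finset (Finset (Fin n)) := {A | k ≤ #A}

variable {n k : ℕ}

theorem mem_upperLevels {A : Finset (Fin n)} : A ∈ upperLevels n k ↔ k ≤ #A := by
  simp [upperLevels]

theorem card_filter_card_eq (n k : ℕ) : #{A : Finset (Fin n) | #A = k} = n.choose k := by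
  rw [univ_filter_card_eq, card_powersetCard, card_univ, Fintype.card_fin]

theorem card_upperLevels (n k : ℕ) : #(upperLevels n k) = ∑ i ∈ Icc k n, n.choose i := by
  rw [card_eq_sum_card_fiberwise (f := Finset.card) (t := Icc k n)]
  · refine sum_congr rfl fun i hi ↦ ?_
    rw [← card_filter_card_eq]
    congr 1
    ext A
    have := (mem_Icc.1 hi).1
    simp only [mem_filter, mem_upperLevels, mem_univ, true_and]
    omega
  · intro A hA
    have := card_le_univ A
    rw [Fintype.card_fin] at this
    exact mem_coe.2 (mem_Icc.2 ⟨mem_upperLevels.1 hA, this⟩)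

theorem two_mul_card_eq_of_union_compls_eq_univ {𝓕 : Finset (Finset (Fin n))}
    (h : ∀ A, A ∈ 𝓕 ∨ Aᶜ ∈ 𝓕) : 2 * #𝓕 = 2 ^ n + #(𝓕 ∩ 𝓕ᶜˢ) := by
  have h1 := card_union_add_card_inter 𝓕 𝓕ᶜˢ
  have h2 : 𝓕 ∪ 𝓕ᶜˢ = univ := eq_univ_iff_forall.2 fun A ↦ by simpa using h A
  rw [h2, card_compls, card_univ, Fintype.card_finset, Fintype.card_fin] at h1
  omega

theorem two_mul_card_upperLevels_even (m : ℕ) :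
    2 * #(upperLevels (2 * m) m) = 2 ^ (2 * m) + (2 * m).choose m := by
  rw [two_mul_card_eq_of_union_compls_eq_univ, ← card_filter_card_eq]
  · congr 2
    ext A
    have h1 := card_compl A
    have h2 := card_le_univ A
    simp only [Fintype.card_fin] at h1 h2
    simp only [mem_inter, mem_compls, mem_upperLevels, mem_filter, mem_univ, true_and]
    omega
  · intro A
    have h1 := card_compl A
    simp only [Fintype.card_fin] at h1
    simp only [mem_upperLevels]
    omega

theorem two_mul_card_upperLevels_odd (m : ℕ) :
    2 * #(upperLevels (2 * m + 1) (m + 1)) = 2 ^ (2 * m + 1) := by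
  rw [two_mul_card_eq_of_union_compls_eq_univ, Nat.add_eq_left, card_eq_zero,
    eq_empty_iff_forall_notMem]
  · intro A
    have h1 := card_compl A
    simp only [Fintype.card_fin] at h1
    simp only [mem_inter, mem_compls, mem_upperLevels]
    omega
  · intro A
    have h1 := card_compl A
    simp only [Fintype.card_fin] at h1
    simp only [mem_upperLevels]
    omega

theorem card_upperLevels_succ (hk : k ≤ n) :
    #(upperLevels n k) = n.choose k + #(upperLevels n (k + 1)) := by
  rw [card_upperLevels, card_upperLevels, ← add_sum_Ioc_eq_sum_Icc hk, Icc_add_one_left_eq_Ioc]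

theorem card_filter_card_eq_notMem_zero (n k : ℕ) :
    #{A : Finset (Fin (n + 1)) | #A = k ∧ 0 ∉ A} = n.choose k := by
  have h : ({A : Finset (Fin (n + 1)) | #A = k ∧ 0 ∉ A} : Finset _) =
      powersetCard k (univ.erase 0) := by
    ext A
    simp only [mem_filter, mem_univ, true_and, mem_powersetCard, subset_erase, subset_univ]
    tauto
  rw [h, card_powersetCard, card_erase_of_mem (mem_univ _), card_univ, Fintype.card_fin,
    Nat.add_sub_cancel]

theorem card_filter_card_eq_mem_zero (n k : ℕ) :
    #{A : Finset (Fin (n + 1)) | #A = k + 1 ∧ 0 ∈ A} = n.choose k := by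
  have h1 := card_filter_add_card_filter_not (s := {A : Finset (Fin (n + 1)) | #A = k + 1})
    (fun A ↦ 0 ∈ A)
  rw [filter_filter, filter_filter, card_filter_card_eq_notMem_zero, card_filter_card_eq,
    Nat.choose_succ_succ, Nat.succ_eq_add_one] at h1
  omega

theorem card_upperLevels_union (p : Finset (Fin n) → Prop) [DecidablePred p] {j : ℕ} (hj : j < k) :
    #(upperLevels n k ∪ ({A | #A = j ∧ p A} : Finset _)) =
      #(upperLevels n k) + #{A | #A = j ∧ p A} := by
  refine card_union_of_disjoint (disjoint_left.2 fun A hA hA' ↦ ?_)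
  have h1 := mem_upperLevels.1 hA
  have h2 := (mem_filter.1 hA').2.1
  omega

theorem eq_compl_of_disjoint_of_card_le {A B : Finset (Fin n)} (h : Disjoint A B)
    (hc : n ≤ #A + #B) : B = Aᶜ := by
  refine eq_of_subset_of_card_le (subset_compl_iff_disjoint_left.2 h) ?_
  rw [card_compl, Fintype.card_fin]
  omega

/-- A family is `(1,t)`-union-intersecting as soon as every member `A` confines the members disjoint
from it to a family of fewer than `t` sets. -/
theorem unionIntersecting_one {t : ℕ} {𝓕 : Finset (Finset (Fin n))}
    (N : Finset (Fin n) → Finset (Finset (Fin n))) (hN : ∀ A ∈ 𝓕, #(N A) < t)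
    (h : ∀ A ∈ 𝓕, ∀ B ∈ 𝓕, Disjoint A B → B ∈ N A) : UnionIntersecting 1 t 𝓕 := by
  rw [unionIntersecting_iff]
  intro S T hS hT hs ht _
  obtain ⟨A, rfl⟩ := card_eq_one.1 hs
  have hA : A ∈ 𝓕 := hS (mem_singleton_self A)
  by_contra! hcon
  have h1 : T ⊆ N A := fun B hB ↦ h A hA B (hT hB)
    (disjoint_iff_inter_eq_empty.2 (hcon A (mem_singleton_self A) B hB))
  have h2 := card_le_card h1
  have h3 := hN A hA
  omega

theorem unionIntersecting_one_two {𝓕 : Finset (Finset (Fin n))}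
    (h : ∀ A ∈ 𝓕, ∀ B ∈ 𝓕, Disjoint A B → n ≤ #A + #B) : UnionIntersecting 1 2 𝓕 :=
  unionIntersecting_one (fun A ↦ {Aᶜ}) (by simp) fun A hA B hB hAB ↦
    mem_singleton.2 (eq_compl_of_disjoint_of_card_le hAB (h A hA B hB hAB))

theorem unionIntersecting_two_two {𝓕 : Finset (Finset (Fin n))}
    (h : ∀ A ∈ 𝓕, ∀ A' ∈ 𝓕, ∀ B ∈ 𝓕, ∀ B' ∈ 𝓕, A ≠ A' → B ≠ B' → ¬ Disjoint (A ∪ A') (B ∪ B')) :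
    UnionIntersecting 2 2 𝓕 := by
  rw [unionIntersecting_iff]
  intro S T hS hT hs ht _
  obtain ⟨A, A', hA, rfl⟩ := card_eq_two.1 hs
  obtain ⟨B, B', hB, rfl⟩ := card_eq_two.1 ht
  simp only [insert_subset_iff, singleton_subset_iff] at hS hT
  by_contra! hcon
  refine h A hS.1 A' hS.2 B hT.1 B' hT.2 hA hB ?_
  simp only [mem_insert, mem_singleton, forall_eq_or_imp, forall_eq,
    ← disjoint_iff_inter_eq_empty] at hcon
  simp only [disjoint_union_left, disjoint_union_right]
  tauto

theorem succ_le_card_union {A B : Finset (Fin n)} (hA : k ≤ #A) (hB : k ≤ #B) (hne : A ≠ B) :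
    k + 1 ≤ #(A ∪ B) := by
  by_contra! hcon
  have h1 : A = A ∪ B := eq_of_subset_of_card_le subset_union_left (by omega)
  have h2 : B = A ∪ B := eq_of_subset_of_card_le subset_union_right (by omega)
  exact hne (h1.trans h2.symm)

theorem card_add_card_le_of_disjoint {A B : Finset (Fin n)} (h : Disjoint A B) : #A + #B ≤ n := by
  rw [← card_union_of_disjoint h]
  simpa using card_le_univ (A ∪ B)

theorem le_maxUnionIntersecting_one_one (n : ℕ) :
    2 ^ (n + 1) ≤ 2 * maxUnionIntersecting (n + 1) 1 1 := by
  have h : UnionIntersecting 1 1 ({A | 0 ∈ A} : Finset (Finset (Fin (n + 1)))) :=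
    unionIntersecting_one (fun _ ↦ ∅) (by simp) fun A hA B hB hAB ↦ by
      simp only [mem_filter, mem_univ, true_and] at hA hB
      exact absurd hB (disjoint_left.1 hAB hA)
  have h1 := h.card_le_max
  have h2 := two_mul_card_eq_of_union_compls_eq_univ
    (𝓕 := ({A | 0 ∈ A} : Finset (Finset (Fin (n + 1))))) (fun A ↦ by
      simp only [mem_filter, mem_univ, true_and, mem_compl]
      tauto)
  omega

theorem le_maxUnionIntersecting_one_two_even (m : ℕ) :
    #(upperLevels (2 * m) m) ≤ maxUnionIntersecting (2 * m) 1 2 :=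
  (unionIntersecting_one_two fun A hA B hB _ ↦ by
    rw [mem_upperLevels] at hA hB
    omega).card_le_max

theorem le_maxUnionIntersecting_one_two_odd (m : ℕ) (hm : 0 < m) :
    (2 * m).choose (m - 1) + #(upperLevels (2 * m + 1) (m + 1)) ≤
      maxUnionIntersecting (2 * m + 1) 1 2 := by
  obtain ⟨k, rfl⟩ : ∃ k, m = k + 1 := ⟨m - 1, by omega⟩
  have h := (unionIntersecting_one_two (𝓕 := upperLevels (2 * (k + 1) + 1) (k + 1 + 1) ∪
    ({A | #A = k + 1 ∧ 0 ∈ A} : Finset _)) (by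
      intro A hA B hB hAB
      have h0 : 0 ∈ A → 0 ∉ B := fun h ↦ disjoint_left.1 hAB h
      simp only [mem_union, mem_upperLevels, mem_filter, mem_univ, true_and] at hA hB
      by_contra! hcon
      exact h0 (hA.resolve_left (by omega)).2 (hB.resolve_left (by omega)).2)).card_le_max
  rw [card_upperLevels_union _ (Nat.lt_add_one _), card_filter_card_eq_mem_zero] at h
  rw [Nat.add_sub_cancel]
  omega

theorem le_maxUnionIntersecting_one_three_odd (m : ℕ) :
    (2 * m).choose m + #(upperLevels (2 * m + 1) (m + 1)) ≤
      maxUnionIntersecting (2 * m + 1) 1 3 := by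
  have h := (unionIntersecting_one (t := 3) (𝓕 := upperLevels (2 * m + 1) (m + 1) ∪
    ({A | #A = m ∧ 0 ∉ A} : Finset _)) (fun A ↦ {Aᶜ, Aᶜ.erase 0})
    (fun A _ ↦ (card_le_two (a := Aᶜ) (b := Aᶜ.erase 0)).trans_lt (by norm_num)) (by
      intro A hA B hB hAB
      simp only [mem_union, mem_upperLevels, mem_filter, mem_univ, true_and] at hA hB
      rw [mem_insert, mem_singleton]
      by_cases hc : 2 * m + 1 ≤ #A + #B
      · exact Or.inl (eq_compl_of_disjoint_of_card_le hAB hc)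
      · right
        have hA0 : 0 ∉ A := by
          have : ¬ (m + 1 ≤ #A) := by omega
          tauto
        have hB0 : 0 ∉ B := by
          have : ¬ (m + 1 ≤ #B) := by omega
          tauto
        refine eq_of_subset_of_card_le
          (subset_erase.2 ⟨subset_compl_iff_disjoint_left.2 hAB, hB0⟩) ?_
        rw [card_erase_of_mem (mem_compl.2 hA0), card_compl, Fintype.card_fin]
        omega)).card_le_max
  rw [card_upperLevels_union _ (Nat.lt_add_one _), card_filter_card_eq_notMem_zero] at h
  omega

theorem le_maxUnionIntersecting_two_two_odd (m : ℕ) :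
    #(upperLevels (2 * m + 1) m) ≤ maxUnionIntersecting (2 * m + 1) 2 2 :=
  (unionIntersecting_two_two fun A hA A' hA' B hB B' hB' hne hne' hd ↦ by
    rw [mem_upperLevels] at hA hA' hB hB'
    have h1 := succ_le_card_union hA hA' hne
    have h2 := succ_le_card_union hB hB' hne'
    have h3 := card_add_card_le_of_disjoint hd
    omega).card_le_max

theorem le_maxUnionIntersecting_two_two_even (m : ℕ) (hm : 2 ≤ m) :
    (2 * m - 1).choose (m - 2) + #(upperLevels (2 * m) m) ≤
      maxUnionIntersecting (2 * m) 2 2 := by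
  obtain ⟨k, rfl⟩ : ∃ k, m = k + 2 := ⟨m - 2, by omega⟩
  rw [show 2 * (k + 2) - 1 = 2 * k + 3 by omega, show 2 * (k + 2) = 2 * k + 3 + 1 by ring,
    Nat.add_sub_cancel]
  have hunion : ∀ A ∈ upperLevels (2 * k + 3 + 1) (k + 2) ∪
      ({A | #A = k + 1 ∧ 0 ∈ A} : Finset _),
      ∀ A' ∈ upperLevels (2 * k + 3 + 1) (k + 2) ∪
      ({A | #A = k + 1 ∧ 0 ∈ A} : Finset _), A ≠ A' →
      k + 2 ≤ #(A ∪ A') ∧ (#(A ∪ A') = k + 2 → 0 ∈ A ∪ A') := by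
    intro A hA A' hA' hne
    simp only [mem_union, mem_upperLevels, mem_filter, mem_univ, true_and] at hA hA'
    refine ⟨succ_le_card_union (k := k + 1) (by omega) (by omega) hne, fun hc ↦ ?_⟩
    by_contra hcon
    rw [mem_union, not_or] at hcon
    have := succ_le_card_union (hA.resolve_right fun h ↦ hcon.1 h.2)
      (hA'.resolve_right fun h ↦ hcon.2 h.2) hne
    omega
  have h := (unionIntersecting_two_two (𝓕 := upperLevels (2 * k + 3 + 1) (k + 2) ∪
    ({A | #A = k + 1 ∧ 0 ∈ A} : Finset _)) (by
      intro A hA A' hA' B hB B' hB' hne hne' hd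
      have h1 := hunion A hA A' hA' hne
      have h2 := hunion B hB B' hB' hne'
      have h3 := card_add_card_le_of_disjoint hd
      exact disjoint_left.1 hd (h1.2 (by omega)) (h2.2 (by omega)))).card_le_max
  rw [card_upperLevels_union _ (show k + 1 < k + 2 by omega),
    card_filter_card_eq_mem_zero] at h
  omega

end Constructions

/-! ### Asymptotic upper bounds -/

section Asymptotics

open Finset Filter
open scoped FinsetFamily Topology

variable {n : ℕ}

/-- Outside the levels within `K` of the top and of the bottom, the complement-closed part of the
family is covered by two families: one whose members lie above few others, and one whose members lie
below few others. The numbers `u` and `v` are the sizes of these two families. -/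
theorem UnionIntersecting.exists_card_inter_compls_le {s t K : ℕ} {𝓕 : Finset (Finset (Fin n))}
    (h : UnionIntersecting s t 𝓕) (hn : 0 < n) (hK : 2 ≤ K) (hs : 2 * s ≤ K) (ht : 2 * t ≤ K) :
    ∃ u v : ℕ, #(𝓕 ∩ 𝓕ᶜˢ) ≤ u + v + 2 * ((K + 1) * n ^ K) ∧ u ≤ 2 ^ n ∧ v ≤ 2 ^ n ∧
      u * (n / 2 - (s - 2)) ≤ n / 2 * n.choose (n / 2) ∧
      v * (n / 2 - (t - 2)) ≤ n / 2 * n.choose (n / 2) ∧ (s = 1 → u = 0) := by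
  -- cutting off the outer levels also removes the empty set
  set 𝓗 := {A ∈ 𝓕 ∩ 𝓕ᶜˢ | K < #A ∧ #A + K < n} with h𝓗
  have hmem : ∀ A ∈ 𝓗, K < #A ∧ #A + K < n := fun A hA ↦ (mem_filter.1 hA).2
  have he : ∅ ∉ 𝓗 := fun h ↦ by simpa using (hmem _ h).1
  set U := {B ∈ 𝓗 | #{A ∈ 𝓗 | A ⊂ B} + 1 < s} with hU
  set V := {B ∈ 𝓗 | #{C ∈ 𝓗 | B ⊂ C} + 1 < t} with hV
  have hUle : ∀ B ∈ U, #{A ∈ U | A ⊂ B} ≤ s - 2 := by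
    intro B hB
    have h1 := (mem_filter.1 hB).2
    have h2 : #{A ∈ U | A ⊂ B} ≤ #{A ∈ 𝓗 | A ⊂ B} :=
      card_le_card (filter_subset_filter _ (filter_subset _ _))
    omega
  have hVle : ∀ B ∈ V, #{C ∈ V | B ⊂ C} ≤ t - 2 := by
    intro B hB
    have h1 := (mem_filter.1 hB).2
    have h2 : #{C ∈ V | B ⊂ C} ≤ #{C ∈ 𝓗 | B ⊂ C} :=
      card_le_card (filter_subset_filter _ (filter_subset _ _))
    omega
  have hlow : #{A : Finset (Fin n) | #A ≤ K} ≤ (K + 1) * n ^ K := by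
    rw [card_eq_sum_card_fiberwise (f := Finset.card) (t := range (K + 1)) (fun A hA ↦ by
      have := (mem_filter.1 hA).2
      simp only [coe_range, Set.mem_Iio]
      omega)]
    refine (sum_le_card_nsmul _ _ (n ^ K) fun i hi ↦ ?_).trans_eq (by simp)
    calc _ ≤ #{A : Finset (Fin n) | #A = i} :=
          card_le_card (filter_subset_filter _ (subset_univ _))
      _ = n.choose i := card_filter_card_eq n i
      _ ≤ n ^ i := Nat.choose_le_pow n i
      _ ≤ n ^ K := Nat.pow_le_pow_right hn (by have := mem_range.1 hi; omega)
  refine ⟨#U, #V, ?_, ?_, ?_, ?_, ?_, ?_⟩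
  · have hcover : 𝓕 ∩ 𝓕ᶜˢ ⊆ (U ∪ V) ∪ (({A | #A ≤ K} : Finset (Finset (Fin n))) ∪
        ({A | #A ≤ K} : Finset (Finset (Fin n)))ᶜˢ) := by
      intro A hA
      by_cases hA' : K < #A ∧ #A + K < n
      · have hAH : A ∈ 𝓗 := mem_filter.2 ⟨hA, hA'⟩
        refine mem_union_left _ ?_
        exact mem_union.2 ((h.card_below_or_card_above (filter_subset _ _) he hAH).imp
          (fun h ↦ mem_filter.2 ⟨hAH, h⟩) (fun h ↦ mem_filter.2 ⟨hAH, h⟩))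
      · refine mem_union_right _ ?_
        have h1 := card_compl A
        rw [Fintype.card_fin] at h1
        simp only [mem_union, mem_compls, mem_filter, mem_univ, true_and]
        omega
    have h1 := (card_le_card hcover).trans (card_union_le _ _)
    have h2 := card_union_le U V
    have h3 := card_union_le ({A | #A ≤ K} : Finset (Finset (Fin n)))
      ({A | #A ≤ K} : Finset (Finset (Fin n)))ᶜˢ
    rw [card_compls] at h3
    omega
  · simpa using card_le_univ U
  · simpa using card_le_univ V
  · have := card_mul_le_of_card_above_le (𝓥 := Uᶜˢ) (s - 2) (by
      intro A hA
      have h1 := hmem _ (mem_filter.1 (mem_compls.1 hA)).1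
      have h2 := card_compl A
      rw [Fintype.card_fin] at h2 ⊢
      omega) (by
      intro A hA
      refine le_of_eq_of_le ?_ (hUle _ (mem_compls.1 hA))
      rw [← card_compls]
      congr 1
      ext B
      simp only [mem_compls, mem_filter, compl_compl]
      refine and_congr_right fun _ ↦ ?_
      have := compl_lt_compl_iff_lt (x := B) (y := Aᶜ)
      rw [compl_compl] at this
      exact this)
    rwa [card_compls, Fintype.card_fin] at this
  · have := card_mul_le_of_card_above_le (𝓥 := V) (t - 2) (by
      intro A hA
      have h1 := hmem _ (mem_filter.1 hA).1
      rw [Fintype.card_fin]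
      omega) hVle
    rwa [Fintype.card_fin] at this
  · rintro rfl
    rw [card_eq_zero, hU, filter_eq_empty_iff]
    intros
    omega

theorem exists_le_choose_half_mul (r : ℕ) :
    ∃ C : ℝ, ∀ n : ℕ, 3 ≤ n → ∀ v : ℕ, v ≤ 2 ^ n →
      v * (n / 2 - r) ≤ n / 2 * n.choose (n / 2) →
      (v : ℝ) ≤ (n.choose (n / 2) : ℝ) * (1 + 2 * r / n + C / (n : ℝ) ^ 2) := by
  -- `n / 2 - r ≥ (n - c) / 2`, whatever the parity of `n`
  set c : ℕ := 2 * r + 1 with hc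
  refine ⟨4 * r * c + 2 ^ (2 * c) * (2 * c) ^ 2, fun n hn v hv hvr ↦ ?_⟩
  have hn0 : (0 : ℝ) < n := by exact_mod_cast (show 0 < n by omega)
  have hB : (1 : ℝ) ≤ n.choose (n / 2) := by
    exact_mod_cast Nat.choose_pos (Nat.div_le_self n 2)
  set B : ℝ := (n.choose (n / 2) : ℝ) with hBdef
  have hr0 : (0 : ℝ) ≤ r := Nat.cast_nonneg r
  have hc0 : (0 : ℝ) ≤ c := Nat.cast_nonneg c
  rcases Nat.lt_or_ge n (2 * c) with hsmall | hlarge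
  · -- for small `n` the constant alone exceeds `2 ^ n * n ^ 2`
    have h1 : (v : ℝ) ≤ 2 ^ (2 * c) := by
      exact_mod_cast hv.trans (Nat.pow_le_pow_right two_pos hsmall.le)
    have h2 : (n : ℝ) ≤ 2 * c := by exact_mod_cast hsmall.le
    have h3 : (2 : ℝ) ^ (2 * c) ≤ (4 * r * c + 2 ^ (2 * c) * (2 * c) ^ 2) / (n : ℝ) ^ 2 := by
      rw [le_div_iff₀ (by positivity)]
      have : (2 : ℝ) ^ (2 * c) * (n : ℝ) ^ 2 ≤ 2 ^ (2 * c) * (2 * c) ^ 2 := by gcongr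
      have : 0 ≤ 4 * (r : ℝ) * c := by positivity
      linarith
    have h4 : (0 : ℝ) ≤ 2 * r / n := by positivity
    have h5 : (v : ℝ) ≤ 1 + 2 * r / n + (4 * r * c + 2 ^ (2 * c) * (2 * c) ^ 2) / (n : ℝ) ^ 2 := by
      linarith
    have h6 : (0 : ℝ) ≤ v := Nat.cast_nonneg v
    calc (v : ℝ) ≤ 1 * (1 + 2 * r / n +
          (4 * r * c + 2 ^ (2 * c) * (2 * c) ^ 2) / (n : ℝ) ^ 2) := by linarith
      _ ≤ _ := mul_le_mul_of_nonneg_right hB (h6.trans h5)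
  · have hkr : r < n / 2 := by omega
    have hkn : (n : ℝ) ≤ 2 * (n / 2 : ℕ) + 1 := by exact_mod_cast (by omega : n ≤ 2 * (n / 2) + 1)
    have hlarge' : 2 * (c : ℝ) ≤ n := by exact_mod_cast hlarge
    have hcr : (c : ℝ) = 2 * r + 1 := by rw [hc]; push_cast; ring
    have hvr' : (v : ℝ) * ((n / 2 : ℕ) - r) ≤ (n / 2 : ℕ) * B := by
      rw [← Nat.cast_sub hkr.le, hBdef]
      exact_mod_cast hvr
    have hkr' : (0 : ℝ) < (n / 2 : ℕ) - r := by
      have : (r : ℝ) < (n / 2 : ℕ) := by exact_mod_cast hkr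
      linarith
    set k : ℝ := ((n / 2 : ℕ) : ℝ) with hk
    have hfac : r ≤ (k - r) * (2 * r / n + 4 * r * c / (n : ℝ) ^ 2) := by
      have h1 : ((n : ℝ) - c) / 2 ≤ k - r := by linarith
      have h2 : (0 : ℝ) ≤ 2 * r / n + 4 * r * c / (n : ℝ) ^ 2 := by positivity
      refine le_trans ?_ (mul_le_mul_of_nonneg_right h1 h2)
      have h3 : ((n : ℝ) - c) / 2 * (2 * r / n + 4 * r * c / (n : ℝ) ^ 2) =
          r + r * c * (n - 2 * c) / (n : ℝ) ^ 2 := by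
        field_simp
        ring
      rw [h3]
      have : 0 ≤ r * c * (n - 2 * c) / (n : ℝ) ^ 2 := by
        have : (0 : ℝ) ≤ n - 2 * c := by linarith
        positivity
      linarith
    have h7 : (v : ℝ) ≤ B * (1 + 2 * r / n + 4 * r * c / (n : ℝ) ^ 2) := by
      refine le_of_mul_le_mul_right ?_ hkr'
      calc (v : ℝ) * (k - r) ≤ k * B := hvr'
        _ ≤ ((k - r) + (k - r) * (2 * r / n + 4 * r * c / (n : ℝ) ^ 2)) * B :=
          mul_le_mul_of_nonneg_right (by linarith) (by linarith)
        _ = _ := by ring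
    refine h7.trans (mul_le_mul_of_nonneg_left ?_ (by linarith))
    rw [add_div (4 * (r : ℝ) * c)]
    have : (0 : ℝ) ≤ 2 ^ (2 * c) * (2 * c) ^ 2 / (n : ℝ) ^ 2 := by positivity
    linarith

/-- The central binomial coefficient outgrows every power of `n`. -/
theorem exists_pow_le_choose_half_mul (K : ℕ) :
    ∃ C : ℝ, ∀ n : ℕ, 3 ≤ n → (n : ℝ) ^ K ≤ (n.choose (n / 2) : ℝ) * (C / (n : ℝ) ^ 2) := by
  obtain ⟨C, hC⟩ := (tendsto_pow_const_div_const_pow_of_one_lt (K + 3)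
    (one_lt_two : (1 : ℝ) < 2)).bddAbove_range
  refine ⟨2 * C, fun n hn ↦ ?_⟩
  have hn0 : (0 : ℝ) < n := by exact_mod_cast (show 0 < n by omega)
  have h1 : (n : ℝ) ^ (K + 3) / 2 ^ n ≤ C := hC (Set.mem_range_self n)
  rw [div_le_iff₀ (by positivity)] at h1
  have h2 : (2 : ℝ) ^ n ≤ (n + 1) * n.choose (n / 2) := by
    have h3 : 2 ^ n ≤ (n + 1) * n.choose (n / 2) := by
      rw [← Nat.sum_range_choose]
      refine (sum_le_card_nsmul _ _ (n.choose (n / 2)) fun i _ ↦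
        Nat.choose_le_middle i n).trans_eq (by simp)
    exact_mod_cast h3
  have hC0 : 0 ≤ C := by
    have h4 : 0 ≤ C * 2 ^ n := le_trans (by positivity) h1
    exact nonneg_of_mul_nonneg_left h4 (by positivity)
  rw [← mul_div_assoc, le_div_iff₀ (by positivity)]
  refine le_of_mul_le_mul_right ?_ hn0
  have hn1 : (n : ℝ) + 1 ≤ 2 * n := by
    have : (1 : ℝ) ≤ n := by exact_mod_cast (show 1 ≤ n by omega)
    linarith
  calc (n : ℝ) ^ K * n ^ 2 * n = n ^ (K + 3) := by ring
    _ ≤ C * 2 ^ n := h1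
    _ ≤ C * ((n + 1) * n.choose (n / 2)) := mul_le_mul_of_nonneg_left h2 hC0
    _ ≤ C * (2 * n * n.choose (n / 2)) := by gcongr
    _ = _ := by ring

theorem two_mul_cast_maxUnionIntersecting_le {n s t u v E : ℕ} {𝓕 : Finset (Finset (Fin n))}
    (hn : 0 < n) (hcard : #𝓕 = maxUnionIntersecting n s t) (h : #(𝓕 ∩ 𝓕ᶜˢ) ≤ u + v + 2 * E) :
    (maxUnionIntersecting n s t : ℝ) ≤ 2 ^ (n - 1) + (u + v) / 2 + E := by
  have h1 := two_mul_card_le_add_card_inter_compls 𝓕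
  obtain ⟨n, rfl⟩ := Nat.exists_eq_succ_of_ne_zero hn.ne'
  rw [hcard, pow_succ] at h1
  have h2 : 2 * maxUnionIntersecting (n + 1) s t ≤ 2 ^ n * 2 + (u + v + 2 * E) := by
    exact h1.trans (Nat.add_le_add_left h _)
  have h3 : (2 : ℝ) * maxUnionIntersecting (n + 1) s t ≤ 2 ^ n * 2 + (u + v + 2 * E) := by
    exact_mod_cast h2
  rw [Nat.succ_sub_one]
  linarith

theorem exists_maxUnionIntersecting_one_le (t : ℕ) (ht : 2 ≤ t) :
    ∃ C : ℝ, ∀ n : ℕ, 3 ≤ n →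
      (maxUnionIntersecting n 1 t : ℝ) ≤ (2 : ℝ) ^ (n - 1) +
        (n.choose (n / 2) : ℝ) * (1 / 2 + ((t : ℝ) - 2) / (n : ℝ) + C / (n : ℝ) ^ 2) := by
  set K := 2 * t with hK
  obtain ⟨C₁, h₁⟩ := exists_le_choose_half_mul (t - 2)
  obtain ⟨C₂, h₂⟩ := exists_pow_le_choose_half_mul K
  refine ⟨C₁ / 2 + (K + 1) * C₂, fun n hn ↦ ?_⟩
  obtain ⟨𝓕, h, hcard⟩ := exists_card_eq_maxUnionIntersecting n 1 t (by omega)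
  obtain ⟨u, v, huv, -, hv, -, hv', hu⟩ := h.exists_card_inter_compls_le (K := K) (by omega)
    (by omega) (by omega) (by omega)
  have h3 := two_mul_cast_maxUnionIntersecting_le (by omega) hcard huv
  have h4 := h₁ n hn v hv hv'
  have h5 := mul_le_mul_of_nonneg_left (h₂ n hn) (show (0 : ℝ) ≤ K + 1 by positivity)
  rw [hu rfl] at h3
  push_cast [ht] at h3 h4
  calc _ ≤ _ := h3
    _ ≤ 2 ^ (n - 1) + (0 + (n.choose (n / 2) : ℝ) * (1 + 2 * (t - 2) / n + C₁ / n ^ 2)) / 2 +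
        (K + 1) * (n.choose (n / 2) * (C₂ / n ^ 2)) := by gcongr
    _ = _ := by ring

theorem exists_maxUnionIntersecting_le (s t : ℕ) (hs : 2 ≤ s) (ht : 2 ≤ t) :
    ∃ C : ℝ, ∀ n : ℕ, 3 ≤ n →
      (maxUnionIntersecting n s t : ℝ) ≤ (2 : ℝ) ^ (n - 1) +
        (n.choose (n / 2) : ℝ) *
          (1 + ((t : ℝ) + (s : ℝ) - 4) / (n : ℝ) + C / (n : ℝ) ^ 2) := by
  set K := 2 * (s + t) with hK
  obtain ⟨C₀, h₀⟩ := exists_le_choose_half_mul (s - 2)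
  obtain ⟨C₁, h₁⟩ := exists_le_choose_half_mul (t - 2)
  obtain ⟨C₂, h₂⟩ := exists_pow_le_choose_half_mul K
  refine ⟨C₀ / 2 + C₁ / 2 + (K + 1) * C₂, fun n hn ↦ ?_⟩
  obtain ⟨𝓕, h, hcard⟩ := exists_card_eq_maxUnionIntersecting n s t (by omega)
  obtain ⟨u, v, huv, hu, hv, hu', hv', -⟩ := h.exists_card_inter_compls_le (K := K) (by omega)
    (by omega) (by omega) (by omega)
  have h3 := two_mul_cast_maxUnionIntersecting_le (by omega) hcard huv
  have h4 := h₀ n hn u hu hu'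
  have h5 := h₁ n hn v hv hv'
  have h6 := mul_le_mul_of_nonneg_left (h₂ n hn) (show (0 : ℝ) ≤ K + 1 by positivity)
  push_cast [hs, ht] at h3 h4 h5
  calc _ ≤ _ := h3
    _ ≤ 2 ^ (n - 1) + ((n.choose (n / 2) : ℝ) * (1 + 2 * (s - 2) / n + C₀ / n ^ 2) +
          (n.choose (n / 2) : ℝ) * (1 + 2 * (t - 2) / n + C₁ / n ^ 2)) / 2 +
        (K + 1) * (n.choose (n / 2) * (C₂ / n ^ 2)) := by gcongr
    _ = _ := by ring

end Asymptotics

/-! ### Lower bounds for large parameters -/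

section LowerBounds

open Finset

theorem two_pow_add_choose_le_maxUnionIntersecting_one_three (n : ℕ) :
    2 ^ n + n.choose (n / 2) ≤ 2 * maxUnionIntersecting n 1 3 := by
  obtain ⟨m, rfl | rfl⟩ := n.even_or_odd'
  · have h1 := le_maxUnionIntersecting_one_two_even m
    have h2 := two_mul_card_upperLevels_even m
    have h3 : maxUnionIntersecting (2 * m) 1 2 ≤ maxUnionIntersecting (2 * m) 1 3 :=
      maxUnionIntersecting_mono (by norm_num) le_rfl (by norm_num)
    rw [Nat.mul_div_cancel_left _ two_pos]
    omega
  · have h1 := le_maxUnionIntersecting_one_three_odd m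
    have h2 := two_mul_card_upperLevels_odd m
    have h3 : (2 * m + 1).choose m ≤ 2 * (2 * m).choose m := by
      rw [← Nat.choose_symm_half, Nat.choose_succ_succ, two_mul ((2 * m).choose m)]
      refine Nat.add_le_add_left ?_ _
      have := Nat.choose_le_middle (m + 1) (2 * m)
      rwa [Nat.mul_div_cancel_left _ two_pos] at this
    rw [show (2 * m + 1) / 2 = m by omega]
    omega

theorem two_pow_add_choose_le_maxUnionIntersecting_two_two (n : ℕ) (hn : 3 ≤ n) :
    (2 : ℝ) ^ n + 2 * ((n.choose (n / 2) : ℝ) * ((n : ℝ) / ((n : ℝ) + 2))) ≤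
      2 * maxUnionIntersecting n 2 2 := by
  obtain ⟨m, rfl | rfl⟩ := n.even_or_odd'
  · have h1 := le_maxUnionIntersecting_two_two_even m (by omega)
    have h2 := two_mul_card_upperLevels_even m
    have h3 : 2 ^ (2 * m) + 2 * (2 * m).choose (m - 1) ≤ 2 * maxUnionIntersecting (2 * m) 2 2 := by
      have h4 := two_mul_choose_two_mul_sub_one (show 0 < m by omega)
      have h5 := choose_two_mul_sub_one (show 2 ≤ m by omega)
      omega
    have h6 : (2 * m).choose m * m = (2 * m).choose (m - 1) * (m + 1) := by
      obtain ⟨k, rfl⟩ : ∃ k, m = k + 1 := ⟨m - 1, by omega⟩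
      rw [Nat.choose_succ_right_eq, Nat.add_sub_cancel]
      congr 1
      omega
    have h7 : ((2 * m).choose m : ℝ) * (((2 * m : ℕ) : ℝ) / (((2 * m : ℕ) : ℝ) + 2)) =
        (2 * m).choose (m - 1) := by
      have h8 : ((2 * m).choose m : ℝ) * m = (2 * m).choose (m - 1) * (m + 1) := by
        exact_mod_cast h6
      rw [← mul_div_assoc, div_eq_iff (by positivity)]
      push_cast
      linarith
    rw [Nat.mul_div_cancel_left _ two_pos, h7]
    exact_mod_cast h3
  · have h1 := le_maxUnionIntersecting_two_two_odd m
    have h2 := two_mul_card_upperLevels_odd m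
    rw [card_upperLevels_succ (by omega)] at h1
    have h3 : 2 ^ (2 * m + 1) + 2 * (2 * m + 1).choose m ≤
        2 * maxUnionIntersecting (2 * m + 1) 2 2 := by omega
    have h4 : (2 : ℝ) ^ (2 * m + 1) + 2 * ((2 * m + 1).choose m : ℝ) ≤
        2 * maxUnionIntersecting (2 * m + 1) 2 2 := by exact_mod_cast h3
    have h5 : ((2 * m + 1 : ℕ) : ℝ) / (((2 * m + 1 : ℕ) : ℝ) + 2) ≤ 1 :=
      (div_le_one (by positivity)).2 (by linarith)
    rw [show (2 * m + 1) / 2 = m by omega]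
    have h6 : ((2 * m + 1).choose m : ℝ) *
        (((2 * m + 1 : ℕ) : ℝ) / (((2 * m + 1 : ℕ) : ℝ) + 2)) ≤ (2 * m + 1).choose m :=
      mul_le_of_le_one_right (by positivity) h5
    linarith

end LowerBounds

theorem theorem3p2 :
    (∀ n : ℕ, 3 ≤ n →
      maxUnionIntersecting n 1 1 = 2 ^ (n - 1) ∧
      (Even n → maxUnionIntersecting n 1 2 = ∑ i ∈ Finset.Icc (n / 2) n, n.choose i) ∧
      (Odd n → maxUnionIntersecting n 1 2 =
        (n - 1).choose ((n - 3) / 2) + ∑ i ∈ Finset.Icc ((n + 1) / 2) n, n.choose i) ∧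
      (Odd n → maxUnionIntersecting n 2 2 = ∑ i ∈ Finset.Icc ((n - 1) / 2) n, n.choose i) ∧
      (Even n → maxUnionIntersecting n 2 2 =
        (n - 1).choose (n / 2 - 2) + ∑ i ∈ Finset.Icc (n / 2) n, n.choose i) ∧
      (Even n → maxUnionIntersecting n 1 3 = ∑ i ∈ Finset.Icc (n / 2) n, n.choose i) ∧
      (Odd n → maxUnionIntersecting n 1 3 =
        (n - 1).choose ((n - 1) / 2) + ∑ i ∈ Finset.Icc ((n + 1) / 2) n, n.choose i)) ∧
    (∀ t : ℕ, 4 ≤ t →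
      (∀ n : ℕ, 3 ≤ n →
        (2 : ℝ) ^ (n - 1) + 1 / 2 * (n.choose (n / 2) : ℝ) ≤ (maxUnionIntersecting n 1 t : ℝ)) ∧
      ∃ C : ℝ, ∀ n : ℕ, 3 ≤ n →
        (maxUnionIntersecting n 1 t : ℝ) ≤ (2 : ℝ) ^ (n - 1) +
          (n.choose (n / 2) : ℝ) * (1 / 2 + ((t : ℝ) - 2) / (n : ℝ) + C / (n : ℝ) ^ 2)) ∧
    (∀ s t : ℕ, 2 ≤ s → 3 ≤ t →
      (∀ n : ℕ, 3 ≤ n →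
        (2 : ℝ) ^ (n - 1) + (n.choose (n / 2) : ℝ) * ((n : ℝ) / ((n : ℝ) + 2)) ≤
          (maxUnionIntersecting n s t : ℝ)) ∧
      ∃ C : ℝ, ∀ n : ℕ, 3 ≤ n →
        (maxUnionIntersecting n s t : ℝ) ≤ (2 : ℝ) ^ (n - 1) +
          (n.choose (n / 2) : ℝ) *
            (1 + ((t : ℝ) + (s : ℝ) - 3) / (n : ℝ) + C / (n : ℝ) ^ 2)) := by

  refine ⟨fun n hn ↦ ⟨?_, ?_, ?_, ?_, ?_, ?_, ?_⟩, fun t ht ↦ ⟨fun n hn ↦ ?_, ?_⟩,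
    fun s t hs ht ↦ ⟨fun n hn ↦ ?_, ?_⟩⟩
  · obtain ⟨n, rfl⟩ := Nat.exists_eq_succ_of_ne_zero (show n ≠ 0 by omega)
    have h1 := maxUnionIntersecting_one_one_le n.succ_pos
    have h2 := le_maxUnionIntersecting_one_one n
    rw [Nat.succ_eq_add_one, pow_succ] at *
    rw [Nat.add_sub_cancel]
    omega
  · intro hpar
    obtain ⟨m, rfl⟩ := even_iff_exists_two_mul.1 hpar
    rw [Nat.mul_div_cancel_left _ two_pos, ← card_upperLevels]
    have h1 := le_maxUnionIntersecting_one_two_even m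
    have h2 := two_mul_card_upperLevels_even m
    have h3 := maxUnionIntersecting_one_three_even_le m (by omega)
    have h4 : maxUnionIntersecting (2 * m) 1 2 ≤ maxUnionIntersecting (2 * m) 1 3 :=
      maxUnionIntersecting_mono (by norm_num) le_rfl (by norm_num)
    omega
  · rintro ⟨m, rfl⟩
    rw [show (2 * m + 1 - 3) / 2 = m - 1 by omega, show (2 * m + 1 + 1) / 2 = m + 1 by omega,
      Nat.add_sub_cancel, ← card_upperLevels]
    have h1 := le_maxUnionIntersecting_one_two_odd m (by omega)
    have h2 := two_mul_card_upperLevels_odd m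
    have h3 := maxUnionIntersecting_one_two_le m (by omega)
    omega
  · rintro ⟨m, rfl⟩
    rw [show (2 * m + 1 - 1) / 2 = m by omega, ← card_upperLevels]
    have h1 := le_maxUnionIntersecting_two_two_odd m
    have h2 := two_mul_card_upperLevels_odd m
    have h3 := maxUnionIntersecting_two_two_odd_le m (by omega)
    have h4 := card_upperLevels_succ (show m ≤ 2 * m + 1 by omega)
    omega
  · intro hpar
    obtain ⟨m, rfl⟩ := even_iff_exists_two_mul.1 hpar
    rw [Nat.mul_div_cancel_left _ two_pos, ← card_upperLevels]
    have h1 := le_maxUnionIntersecting_two_two_even m (by omega)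
    have h2 := two_mul_card_upperLevels_even m
    have h3 := maxUnionIntersecting_two_two_even_le m (by omega)
    have h4 := two_mul_choose_two_mul_sub_one (show 0 < m by omega)
    have h5 := choose_two_mul_sub_one (show 2 ≤ m by omega)
    omega
  · intro hpar
    obtain ⟨m, rfl⟩ := even_iff_exists_two_mul.1 hpar
    rw [Nat.mul_div_cancel_left _ two_pos, ← card_upperLevels]
    have h1 := le_maxUnionIntersecting_one_two_even m
    have h2 := two_mul_card_upperLevels_even m
    have h3 := maxUnionIntersecting_one_three_even_le m (by omega)
    have h4 : maxUnionIntersecting (2 * m) 1 2 ≤ maxUnionIntersecting (2 * m) 1 3 :=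
      maxUnionIntersecting_mono (by norm_num) le_rfl (by norm_num)
    omega
  · rintro ⟨m, rfl⟩
    rw [Nat.add_sub_cancel, Nat.mul_div_cancel_left _ two_pos,
      show (2 * m + 1 + 1) / 2 = m + 1 by omega, ← card_upperLevels]
    have h1 := le_maxUnionIntersecting_one_three_odd m
    have h2 := two_mul_card_upperLevels_odd m
    have h3 := maxUnionIntersecting_one_three_odd_le m (by omega)
    omega
  · have h1 := two_pow_add_choose_le_maxUnionIntersecting_one_three n
    have h2 : maxUnionIntersecting n 1 3 ≤ maxUnionIntersecting n 1 t :=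
      maxUnionIntersecting_mono (by norm_num) le_rfl (by omega)
    have h3 : (2 : ℝ) ^ n + n.choose (n / 2) ≤ 2 * maxUnionIntersecting n 1 t := by
      exact_mod_cast h1.trans (Nat.mul_le_mul_left 2 h2)
    rw [← pow_sub_one_mul (show n ≠ 0 by omega)] at h3
    linarith
  · exact exists_maxUnionIntersecting_one_le t (by omega)
  · have h1 := two_pow_add_choose_le_maxUnionIntersecting_two_two n hn
    have h2 : (maxUnionIntersecting n 2 2 : ℝ) ≤ maxUnionIntersecting n s t := by
      exact_mod_cast maxUnionIntersecting_mono (by norm_num) hs (by omega)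
    rw [← pow_sub_one_mul (show n ≠ 0 by omega)] at h1
    linarith
  · obtain ⟨C, hC⟩ := exists_maxUnionIntersecting_le s t hs (by omega)
    refine ⟨C, fun n hn ↦ (hC n hn).trans ?_⟩
    gcongr
    norm_num
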